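/- Let $K$ be a field and let $\mathcal A$ be an essential affine complex hyperplane arrangement: a finite set of affine hyperplanes in $\mathbb C^\ell$, some of which intersect in exactly one point. Let $V=E_1$ be the $K$-vector space with basis $\{e_H\}_{H\in\mathcal A}$, let $E=\bigwedge V$ be its exterior algebra, and let $A=E/I$ be the Orlik–Solomon algebra of $\mathcal A$. Here $I$ is the two-sided ideal generated by the elements $$\partial(e_{H_1}\wedge\cdots\wedge e_{H_t})=\sum_j(-1)^{j}\,e_{H_1}\wedge\cdots\wedge\widehat{e_{H_j}}\wedge\cdots\wedge e_{H_t}$$ for the minimal dependent sets $\{H_1,\dots,H_t\}\subseteq\mathcal A$ of $t$ distinct hyperplanes, and by the monomials $e_{H_1}\wedge\cdots\wedge e_{H_t}$ for the sets $\{H_1,\dots,H_t\}\subseteq\mathcal A$ with $H_1\cap\cdots\cap H_t=\emptyset$; a set of $t$ hyperplanes is dependent if its intersection is nonempty and of codimension less than $t$. For an $E$-module $M$, the singular variety of $M$ is the set of all $x\in V$ such that $\{m\in M: xm=0\}\neq xM$. The arrangement is central if its hyperplanes have a common point. It is irreducible if it is nonempty and is not, after an affine change of coordinates $\mathbb C^\ell\cong\mathbb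 C^{k_1}\times\mathbb C^{k_2}$, a product of two nonempty arrangements $\mathcal A_1$, $\mathcal A_2$, the product being the arrangement of all $H\times\mathbb C^{k_2}$ with $H\in\mathcal A_1$ and all $\mathbb C^{k_1}\times H$ with $H\in\mathcal A_2$. Theorem 2.2. Suppose that $\mathcal A$ is irreducible. Then the classes of the $e_H$ in $A$ are linearly independent over $K$, so that $V$ is identified with $A_1$, and: (a) if $\mathcal A$ is noncentral, then the singular variety of the $E$-module $A$ is all of $V$; (b) if $\mathcal A$ is central, then the singular variety of the $E$-module $A$ is the linear span of the differences $e_H-e_{H'}$ with $H,H'\in\mathcal A$, and this span is a hyperplane in $V$ (a linear subspace of codimension one). -/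

import Mathlib

noncomputable section

/-- An affine subspace of a complex vector space is an (affine) hyperplane if it is
`{x | α x = c}` for some nonzero linear form `α` and some constant `c`. -/
def IsAffineHyperplane {W : Type*} [AddCommGroup W] [Module ℂ W]
    (H : AffineSubspace ℂ W) : Prop :=
  ∃ (α : W →ₗ[ℂ] ℂ) (c : ℂ), α ≠ 0 ∧ (H : Set W) = {x | α x = c}

/-- An affine complex hyperplane arrangement: a finite set of affine hyperplanes. -/
structure HyperplaneArrangement (W : Type*) [AddCommGroup W] [Module ℂ W] where
  hyperplanes : Set (AffineSubspace ℂ W)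
  finite : hyperplanes.Finite
  isHyperplane : ∀ H ∈ hyperplanes, IsAffineHyperplane H

/-- A set of hyperplanes is dependent if its intersection is nonempty and has codimension
smaller than the number of hyperplanes. (For finite sets of affine hyperplanes with a common
point, this is linear dependence of the linear forms defining them.) -/
def HyperplanesDependent {W : Type*} [AddCommGroup W] [Module ℂ W]
    (S : Set (AffineSubspace ℂ W)) : Prop :=
  ((sInf S : AffineSubspace ℂ W) : Set W).Nonempty ∧
    Module.finrank ℂ W < Module.finrank ℂ (sInf S : AffineSubspace ℂ W).direction + S.ncard

namespace HyperplaneArrangement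

section Geometry

variable {W W₁ W₂ : Type*} [AddCommGroup W] [Module ℂ W] [AddCommGroup W₁] [Module ℂ W₁]
  [AddCommGroup W₂] [Module ℂ W₂]

/-- An arrangement is central if its hyperplanes have a common point. -/
def IsCentral (𝒜 : HyperplaneArrangement W) : Prop :=
  ∃ p : W, ∀ H ∈ 𝒜.hyperplanes, p ∈ H

/-- An arrangement is essential if its intersection poset has rank `dim W`, that is, if some
intersection of hyperplanes of the arrangement is a single point. -/
def IsEssential (𝒜 : HyperplaneArrangement W) : Prop :=
  ∃ S ⊆ 𝒜.hyperplanes, ∃ p : W, ((sInf S : AffineSubspace ℂ W) : Set W) = {p}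

/-- The product arrangement in `W₁ × W₂`, consisting of the hyperplanes `H × W₂` for `H ∈ 𝒜₁`
and `W₁ × H` for `H ∈ 𝒜₂`. -/
def prod (𝒜₁ : HyperplaneArrangement W₁) (𝒜₂ : HyperplaneArrangement W₂) :
    HyperplaneArrangement (W₁ × W₂) where
  hyperplanes :=
    (fun H => H.comap (LinearMap.fst ℂ W₁ W₂).toAffineMap) '' 𝒜₁.hyperplanes ∪
      (fun H => H.comap (LinearMap.snd ℂ W₁ W₂).toAffineMap) '' 𝒜₂.hyperplanes
  finite := (𝒜₁.finite.image _).union (𝒜₂.finite.image _)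
  isHyperplane := by
    rintro _ (⟨H, hH, rfl⟩ | ⟨H, hH, rfl⟩)
    · obtain ⟨α, c, hα, h⟩ := 𝒜₁.isHyperplane H hH
      refine ⟨α ∘ₗ LinearMap.fst ℂ W₁ W₂, c, fun h0 => hα ?_, ?_⟩
      · ext x
        simpa using LinearMap.congr_fun h0 (x, 0)
      · ext x
        have := Set.ext_iff.mp h x.1
        simpa using this
    · obtain ⟨α, c, hα, h⟩ := 𝒜₂.isHyperplane H hH
      refine ⟨α ∘ₗ LinearMap.snd ℂ W₁ W₂, c, fun h0 => hα ?_, ?_⟩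
      · ext x
        simpa using LinearMap.congr_fun h0 (0, x)
      · ext x
        have := Set.ext_iff.mp h x.2
        simpa using this

/-- An arrangement in `ℂ^ℓ` is irreducible if it is nonempty and is not, after an affine change
of coordinates, the product of two nonempty arrangements. -/
def IsIrreducible {ℓ : ℕ} (𝒜 : HyperplaneArrangement (Fin ℓ → ℂ)) : Prop :=
  𝒜.hyperplanes.Nonempty ∧
    ∀ (k₁ k₂ : ℕ) (𝒜₁ : HyperplaneArrangement (Fin k₁ → ℂ))
      (𝒜₂ : HyperplaneArrangement (Fin k₂ → ℂ))
      (φ : (Fin ℓ → ℂ) ≃ᵃ[ℂ] (Fin k₁ → ℂ) × (Fin k₂ → ℂ)),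
      𝒜.hyperplanes =
        (fun H => H.comap (φ : (Fin ℓ → ℂ) →ᵃ[ℂ] (Fin k₁ → ℂ) × (Fin k₂ → ℂ))) ''
          (𝒜₁.prod 𝒜₂).hyperplanes →
      𝒜₁.hyperplanes = ∅ ∨ 𝒜₂.hyperplanes = ∅

end Geometry

section OrlikSolomon

variable (K : Type*) [Field K] {W : Type*} [AddCommGroup W] [Module ℂ W]
  (𝒜 : HyperplaneArrangement W)

/-- The vector space `V = E₁` with basis indexed by the hyperplanes of the arrangement. -/
abbrev V : Type _ := 𝒜.hyperplanes →₀ K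

/-- The basis vector `e_H` of `V`. -/
def e (H : 𝒜.hyperplanes) : 𝒜.V K := Finsupp.single H 1

/-- The exterior algebra `E` on `V`. -/
abbrev E : Type _ := ExteriorAlgebra K (𝒜.V K)

/-- The monomial `e_{H₁} ∧ ⋯ ∧ e_{H_t}`. -/
def monomial {t : ℕ} (H : Fin t → 𝒜.hyperplanes) : 𝒜.E K :=
  ExteriorAlgebra.ιMulti K t (fun j => 𝒜.e K (H j))

/-- `∂(e_{H₀} ∧ ⋯ ∧ e_{H_t}) = ∑ⱼ (-1)ʲ e_{H₀} ∧ ⋯ (omit e_{Hⱼ}) ⋯ ∧ e_{H_t}`. -/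
def boundary {t : ℕ} (H : Fin (t + 1) → 𝒜.hyperplanes) : 𝒜.E K :=
  ∑ j : Fin (t + 1), (-1 : 𝒜.E K) ^ (j : ℕ) * 𝒜.monomial K (fun k => H (j.succAbove k))

/-- The generators of the Orlik–Solomon ideal: the elements `∂(e_{H₀} ∧ ⋯ ∧ e_{H_t})` for
minimal dependent sets of hyperplanes, and the monomials `e_{H₁} ∧ ⋯ ∧ e_{H_t}` for sets of
hyperplanes with empty intersection. Every set is taken with all its orderings, which
changes the generators only by signs. -/
def orlikSolomonGenerators : Set (𝒜.E K) :=
  {r | ∃ (t : ℕ) (H : Fin (t + 1) → 𝒜.hyperplanes), Function.Injective H ∧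
      Minimal HyperplanesDependent (Set.range fun j => (H j : AffineSubspace ℂ W)) ∧
      r = 𝒜.boundary K H} ∪
  {r | ∃ (t : ℕ) (H : Fin t → 𝒜.hyperplanes), Function.Injective H ∧
      (⋂ j, ((H j : AffineSubspace ℂ W) : Set W)) = ∅ ∧
      r = 𝒜.monomial K H}

/-- The Orlik–Solomon ideal, a two-sided ideal of `E`. -/
def orlikSolomonIdeal : Ideal (𝒜.E K) :=
  (TwoSidedIdeal.span (𝒜.orlikSolomonGenerators K)).asIdeal

instance : (𝒜.orlikSolomonIdeal K).IsTwoSided := by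
  unfold orlikSolomonIdeal; infer_instance

/-- The Orlik–Solomon algebra `A = E / I`; it is a ring, a `K`-algebra and an `E`-module. -/
abbrev OrlikSolomonAlgebra : Type _ := 𝒜.E K ⧸ 𝒜.orlikSolomonIdeal K

/-- The class of `e_H` in the Orlik–Solomon algebra. -/
def eClass (H : 𝒜.hyperplanes) : 𝒜.OrlikSolomonAlgebra K :=
  Ideal.Quotient.mk (𝒜.orlikSolomonIdeal K) (ExteriorAlgebra.ι K (𝒜.e K H))

end OrlikSolomon

end HyperplaneArrangement

/-- The singular variety of a module `M` over the exterior algebra on `V`: the set of `x ∈ V`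
for which the set of elements of `M` annihilated by `x` is not the same as `xM`. -/
def singularVariety (K V M : Type*) [Field K] [AddCommGroup V] [Module K V] [AddCommGroup M]
    [Module (ExteriorAlgebra K V) M] : Set V :=
  {x | {m : M | ExteriorAlgebra.ι K x • m = 0} ≠
    Set.range fun m : M => ExteriorAlgebra.ι K x • m}

end

open Module

/-! Multiplication by x squares to zero on A and raises degree by one, so x lies outside the
singular variety exactly when the complex (A, x) is exact. Exactness forces the even and odd parts
of A to have equal dimension. The signed count of a monomial basis is thus an obstruction that does
not depend on x, and the main point is that irreducibility makes such a count nonzero.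

A hyperplane α = c is encoded by the vector (α, c) of W* × ℂ, and w = (0, 1) stands for the
hyperplane at infinity. Hyperplanes have empty intersection iff w lies in the span of their vectors;
otherwise dependence is linear dependence. The sets without broken circuits, with w counted as
smallest element, index a basis of A: straightening (`IsOrlikSolomon.mono_mem`) shows that they
span, and the algebra maps `levelHom` yield dual forms proving independence
(`IsOrlikSolomon.linearIndependent`). Their signed count `nbcSum` satisfies deletion-contraction; up
to sign it is Crapo's beta invariant, positive for connected configurations (`nbcSum_sign`).
Connectedness follows from irreducibility, since forms falling into two independent parts split the
arrangement (`IsIrreducible.not_disjoint`).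

This settles the noncentral case. In the central case let ∂ be contraction by the coordinate sum s.
It preserves I, and ∂(xq) = s(x)q - x∂q is a contracting homotopy when s(x) ≠ 0. When s(x) = 0,
exactness passes to the quotient of A by one generator e_{H₀} (`IsCentral.exact_relationsMod`). That
quotient obeys the same kind of relations with w replaced by the vector of H₀, so the counting
argument applies to it. `IsOrlikSolomon` collects what both quotients share. -/

namespace OrlikSolomon

/-! ### Contraction of the exterior algebra as the boundary operator. -/

section Contraction

variable {K V V' : Type*} [Field K] [AddCommGroup V] [Module K V] [AddCommGroup V'] [Module K V']

/-- Contraction of the exterior algebra by a linear form. -/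
noncomputable def contract (d : Module.Dual K V) : ExteriorAlgebra K V →ₗ[K] ExteriorAlgebra K V :=
  CliffordAlgebra.contractLeft d

/-- The grade involution of the exterior algebra. -/
noncomputable def involution : ExteriorAlgebra K V →ₐ[K] ExteriorAlgebra K V :=
  ExteriorAlgebra.map (-LinearMap.id)

@[simp] lemma involution_ι (x : V) :
    involution (ExteriorAlgebra.ι K x) = -ExteriorAlgebra.ι K x := by
  simp [involution]

@[simp] lemma contract_one (d : Module.Dual K V) : contract d 1 = 0 :=
  CliffordAlgebra.contractLeft_one 0 d

@[simp] lemma contract_algebraMap (d : Module.Dual K V) (c : K) :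
    contract d (algebraMap K _ c) = 0 :=
  CliffordAlgebra.contractLeft_algebraMap 0 d c

lemma contract_ι_mul (d : Module.Dual K V) (x : V) (y : ExteriorAlgebra K V) :
    contract d (ExteriorAlgebra.ι K x * y) = d x • y - ExteriorAlgebra.ι K x * contract d y :=
  CliffordAlgebra.contractLeft_ι_mul d x y

lemma contract_ι (d : Module.Dual K V) (x : V) :
    contract d (ExteriorAlgebra.ι K x) = algebraMap K _ (d x) :=
  CliffordAlgebra.contractLeft_ι 0 d x

lemma exterior_left_induction {P : ExteriorAlgebra K V → Prop}
    (halg : ∀ c, P (algebraMap K _ c)) (hadd : ∀ a b, P a → P b → P (a + b))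
    (hmul : ∀ a x, P a → P (ExteriorAlgebra.ι K x * a)) (a : ExteriorAlgebra K V) : P a :=
  CliffordAlgebra.left_induction 0 (P := P) halg hadd hmul a

lemma contract_mul (d : Module.Dual K V) (a b : ExteriorAlgebra K V) :
    contract d (a * b) = contract d a * b + involution a * contract d b := by
  induction a using exterior_left_induction with
  | halg c => simp [← Algebra.smul_def]
  | hadd a b ha hb => simp only [add_mul, map_add, ha, hb]; abel
  | hmul a y ha =>
    rw [mul_assoc, contract_ι_mul, contract_ι_mul, ha, map_mul, involution_ι]
    simp only [sub_mul, mul_add, neg_mul, smul_mul_assoc, mul_assoc]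
    abel

lemma contract_contract (d : Module.Dual K V) (a : ExteriorAlgebra K V) :
    contract d (contract d a) = 0 :=
  CliffordAlgebra.contractLeft_contractLeft d a

lemma involution_contract (d : Module.Dual K V) (a : ExteriorAlgebra K V) :
    involution (contract d a) = -contract d (involution a) := by
  induction a using exterior_left_induction with
  | halg c => simp
  | hadd a b ha hb => simp [ha, hb, add_comm]
  | hmul a y ha =>
    simp only [contract_ι_mul, map_sub, map_smul, map_mul, ha, involution_ι, neg_mul, mul_neg,
      neg_neg, map_neg, neg_sub]

lemma map_contract (f : V →ₗ[K] V') (d : Module.Dual K V') (a : ExteriorAlgebra K V) :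
    ExteriorAlgebra.map f (contract (d ∘ₗ f) a) = contract d (ExteriorAlgebra.map f a) := by
  induction a using exterior_left_induction with
  | halg c => simp
  | hadd a b ha hb => simp [ha, hb]
  | hmul a y ha => simp [contract_ι_mul, ha]

lemma contract_ιMulti (d : Module.Dual K V) (t : ℕ) (x : Fin (t + 1) → V) :
    contract d (ExteriorAlgebra.ιMulti K (t + 1) x) =
      ∑ j : Fin (t + 1), (-1 : ExteriorAlgebra K V) ^ (j : ℕ) *
        (d (x j) • ExteriorAlgebra.ιMulti K t (fun k => x (j.succAbove k))) := by
  induction t with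
  | zero => simp [ExteriorAlgebra.ιMulti_apply, contract_ι, Algebra.algebraMap_eq_smul_one]
  | succ t ih =>
    rw [ExteriorAlgebra.ιMulti_succ_apply, contract_ι_mul, ih, Fin.sum_univ_succ (n := t + 1),
      Finset.mul_sum, sub_eq_add_neg, ← Finset.sum_neg_distrib]
    congr 1
    · simp [Matrix.vecTail, Function.comp_def]
    · refine Finset.sum_congr rfl fun j _ => ?_
      rw [ExteriorAlgebra.ιMulti_succ_apply]
      have hc : ∀ (n : ℕ) (z : ExteriorAlgebra K V), z * (-1) ^ n = (-1) ^ n * z := fun n z =>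
        ((Commute.neg_one_right z).pow_right n).eq
      simp only [Matrix.vecTail, Function.comp_def, Fin.succ_succAbove_zero,
        Fin.succ_succAbove_succ, Fin.val_succ, pow_succ, mul_neg, mul_one, neg_mul,
        mul_smul_comm, ← mul_assoc, hc, smul_neg]

end Contraction

/-! ### Monomials and their coefficient forms. -/

section Monomials

variable {K ι : Type*} [Field K]

variable (K) in
/-- The product of the basis vectors indexed by a list. -/
noncomputable def mono (l : List ι) : ExteriorAlgebra K (ι →₀ K) :=
  (l.map fun i => ExteriorAlgebra.ι K (Finsupp.single i (1 : K))).prod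

variable (K ι) in
/-- The linear form on `ι →₀ K` summing the coordinates. -/
noncomputable def coordSum : Module.Dual K (ι →₀ K) := Finsupp.linearCombination K fun _ : ι => (1 : K)

@[simp] lemma coordSum_single (i : ι) (c : K) : coordSum K ι (Finsupp.single i c) = c := by
  simp [coordSum]

@[simp] lemma mono_nil : mono K ([] : List ι) = 1 := rfl

lemma mono_cons (i : ι) (l : List ι) :
    mono K (i :: l) = ExteriorAlgebra.ι K (Finsupp.single i (1 : K)) * mono K l := by
  simp [mono]

lemma mono_append (l l' : List ι) : mono K (l ++ l') = mono K l * mono K l' := by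
  simp [mono]

lemma mono_perm {l l' : List ι} (h : l.Perm l') : mono K l = mono K l' ∨ mono K l = -mono K l' := by
  induction h with
  | nil => simp
  | cons x _ ih => rcases ih with h | h <;> simp [mono_cons, h]
  | swap x y l =>
    right
    have h := eq_neg_of_add_eq_zero_left
      (ExteriorAlgebra.ι_add_mul_swap (R := K) (Finsupp.single y (1 : K)) (Finsupp.single x 1))
    simp only [mono_cons, ← mul_assoc, h, neg_mul]
  | trans _ _ ih ih' => rcases ih with h | h <;> rcases ih' with h' | h' <;> simp [h, h']

lemma mono_mem_of_perm {P : Submodule K (ExteriorAlgebra K (ι →₀ K))} {l l' : List ι}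
    (h : l.Perm l') (hl : mono K l' ∈ P) : mono K l ∈ P := by
  rcases mono_perm (K := K) h with h | h <;> simp [h, hl]

lemma mono_eq_zero {l : List ι} (h : ¬ l.Nodup) : mono K l = 0 := by
  have hv : ¬ Function.Injective
      (fun k : Fin l.length => (Finsupp.single (l.get k) (1 : K) : ι →₀ K)) := by
    intro hinj
    exact h (List.nodup_iff_injective_get.mpr fun a b hab => hinj (by simp only [hab]))
  have := ExteriorAlgebra.ιMulti_eq_zero_of_not_inj (R := K) hv
  rw [ExteriorAlgebra.ιMulti_apply] at this
  rw [mono, ← this]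
  congr 1
  apply List.ext_get <;> simp

lemma involution_mono (l : List ι) : involution (mono K l) = (-1) ^ l.length * mono K l := by
  induction l with
  | nil => simp
  | cons i l ih =>
    have hc : ∀ (n : ℕ) (z : ExteriorAlgebra K (ι →₀ K)), z * (-1) ^ n = (-1) ^ n * z :=
      fun n z => ((Commute.neg_one_right z).pow_right n).eq
    rw [mono_cons, map_mul, ih, involution_ι, ← mul_assoc, neg_mul, hc, List.length_cons, pow_succ]
    simp [mul_assoc]

lemma map_mono {κ : Type*} (f : (ι →₀ K) →ₗ[K] (κ →₀ K)) (g : ι → κ)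
    (hf : ∀ i, f (Finsupp.single i 1) = Finsupp.single (g i) 1) (l : List ι) :
    ExteriorAlgebra.map f (mono K l) = mono K (l.map g) := by
  induction l with
  | nil => simp
  | cons i l ih => simp [mono_cons, ih, hf]

/-- The monomials span the exterior algebra. -/
lemma span_range_mono : Submodule.span K (Set.range (mono K (ι := ι))) = ⊤ := by
  rw [eq_top_iff]
  rintro a -
  induction a using exterior_left_induction with
  | halg c =>
    rw [Algebra.algebraMap_eq_smul_one]
    exact Submodule.smul_mem _ _ (Submodule.subset_span ⟨[], rfl⟩)
  | hadd a b ha hb => exact add_mem ha hb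
  | hmul a x ha =>
    induction x using Finsupp.induction_linear with
    | zero => simp
    | add x y hx hy => simpa [add_mul] using add_mem hx hy
    | single i c =>
      induction ha using Submodule.span_induction with
      | zero => simp
      | add y z _ _ hy hz => simpa [mul_add] using add_mem hy hz
      | smul d y _ hy => simpa using Submodule.smul_mem _ d hy
      | mem y hy =>
        obtain ⟨l, rfl⟩ := hy
        have : (Finsupp.single i c : ι →₀ K) = c • Finsupp.single i 1 := by simp
        rw [this, map_smul, smul_mul_assoc, ← mono_cons]
        exact Submodule.smul_mem _ _ (Submodule.subset_span ⟨_, rfl⟩)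

/-- The boundary of a monomial is a combination of monomials with one factor removed. -/
lemma contract_mono_mem (d : Module.Dual K (ι →₀ K)) (l : List ι) :
    contract d (mono K l) ∈
      Submodule.span K {y | ∃ (i : ι) (l' : List ι), l.Perm (i :: l') ∧ y = mono K l'} := by
  induction l with
  | nil => simp
  | cons i l ih =>
    rw [mono_cons, contract_ι_mul]
    refine sub_mem (Submodule.smul_mem _ _ (Submodule.subset_span ⟨i, l, .refl _, rfl⟩)) ?_
    generalize contract d (mono K l) = y at ih
    induction ih using Submodule.span_induction with
    | zero => simp
    | add y z _ _ hy hz => simpa [mul_add] using add_mem hy hz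
    | smul d y _ hy => simpa using Submodule.smul_mem _ d hy
    | mem y hy =>
      obtain ⟨j, l', h, rfl⟩ := hy
      exact Submodule.subset_span
        ⟨j, i :: l', (h.cons i).trans (List.Perm.swap _ _ _), (mono_cons _ _).symm⟩

/-- The linear form on the exterior algebra reading off the coefficient of a monomial. -/
noncomputable def coeff : List ι → ExteriorAlgebra K (ι →₀ K) →ₗ[K] K
  | [] => ExteriorAlgebra.algebraMapInv.toLinearMap
  | i :: l => coeff l ∘ₗ contract (Finsupp.lapply i)

lemma contract_mono_of_notMem {i : ι} {l : List ι} (h : i ∉ l) :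
    contract (Finsupp.lapply i) (mono K l) = 0 := by
  induction l with
  | nil => simp
  | cons j l ih =>
    simp only [List.mem_cons, not_or] at h
    rw [mono_cons, contract_ι_mul, ih h.2]
    simp [Ne.symm h.1]

lemma contract_mono_cons_self {i : ι} {l : List ι} (h : i ∉ l) :
    contract (Finsupp.lapply i) (mono K (i :: l)) = mono K l := by
  rw [mono_cons, contract_ι_mul, contract_mono_of_notMem h]
  simp

lemma coeff_self {l : List ι} (h : l.Nodup) : coeff l (mono K l) = 1 := by
  induction l with
  | nil => simp [coeff]
  | cons i l ih =>
    rw [List.nodup_cons] at h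
    rw [coeff, LinearMap.comp_apply, contract_mono_cons_self h.1, ih h.2]

lemma coeff_of_not_perm {m l : List ι} (h : ¬ l.Perm m) : coeff m (mono K l) = 0 := by
  by_cases hl : l.Nodup
  swap
  · rw [mono_eq_zero hl, map_zero]
  induction m generalizing l with
  | nil =>
    cases l with
    | nil => simp at h
    | cons i l => simp [coeff, mono_cons, ExteriorAlgebra.algebraMapInv]
  | cons i m ih =>
    classical
    rw [coeff, LinearMap.comp_apply]
    by_cases hi : i ∈ l
    · have hp := List.perm_cons_erase hi
      have hn : i ∉ l.erase i := hl.not_mem_erase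
      have h' : coeff m (mono K (l.erase i)) = 0 :=
        ih (fun hm => h (hp.trans (hm.cons i))) (hl.erase i)
      rcases mono_perm (K := K) hp with e | e <;> rw [e] <;>
        simp [contract_mono_cons_self hn, h']
    · rw [contract_mono_of_notMem hi, map_zero]

end Monomials

end OrlikSolomon

namespace OrlikSolomon

/-! ### Sets without broken circuits and deletion-contraction. -/

section BrokenCircuits

variable {F U ι : Type*} [Field F] [AddCommGroup U] [Module F U] (v : ι → U) (w : U) (r : ι → ℕ)

/-- The set `S` contains no broken circuit of the contraction by `N` of the vectors `w` and `v i`,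
`i ∈ X`, where `w` is the smallest element and the others are ordered by `r`, and it does not
contain `w` in its closure. -/
def IsNbc (N : Submodule F U) (X S : Finset ι) : Prop :=
  (∀ i ∈ X, v i ∉ N ⊔ Submodule.span F (v '' {s | s ∈ S ∧ r i < r s})) ∧
    w ∉ N ⊔ Submodule.span F (v '' (S : Set ι))

open Classical in
/-- The signed count of the subsets of `X` without broken circuits. -/
noncomputable def nbcSum (N : Submodule F U) (X : Finset ι) : ℤ :=
  ∑ S ∈ X.powerset, if IsNbc v w r N X S then (-1) ^ S.card else 0

/-- The span of `N`, `w` and the `v i` for `i ∈ X`. -/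
def closure (N : Submodule F U) (X : Set ι) : Submodule F U :=
  N ⊔ Submodule.span F {w} ⊔ Submodule.span F (v '' X)

/-- The vectors `w` and `v i`, `i ∈ X`, are connected modulo `N`. -/
def IsConn (N : Submodule F U) (X : Finset ι) : Prop :=
  w ∉ N ∧ ∀ Y ⊆ X, Y.Nonempty →
    ¬ closure v w N (X \ Y : Set ι) ⊓ (N ⊔ Submodule.span F (v '' (Y : Set ι))) ≤ N

variable {v w r}

lemma nbcSum_empty {N : Submodule F U} (hw : w ∉ N) : nbcSum v w r N ∅ = 1 := by
  simp [nbcSum, IsNbc, hw]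

lemma nbcSum_empty_of_mem {N : Submodule F U} (hw : w ∈ N) : nbcSum v w r N ∅ = 0 := by
  simp [nbcSum, IsNbc, hw]

lemma nbcSum_eq_zero_of_mem {N : Submodule F U} {X : Finset ι} {n : ι} (hn : n ∈ X)
    (h : v n ∈ N) : nbcSum v w r N X = 0 :=
  Finset.sum_eq_zero fun _ _ => if_neg fun hS => hS.1 n hn (Submodule.mem_sup_left h)

lemma isNbc_insert_of_subset {N : Submodule F U} {X S : Finset ι} {n : ι} [DecidableEq ι]
    (hmax : ∀ i ∈ X, r i < r n) (h : v n ∉ N) (hS : S ⊆ X) :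
    IsNbc v w r N (insert n X) S ↔ IsNbc v w r N X S := by
  have he : {s | s ∈ S ∧ r n < r s} = ∅ := by
    ext s; simpa using fun hs => (hmax s (hS hs)).le
  simp [IsNbc, he, h]

/-- The element n exceeds every i in X, so it belongs to every final segment of S ∪ {n} used in the
test and can be absorbed into N. -/
lemma isNbc_insert_insert {N : Submodule F U} {X S : Finset ι} {n : ι} [DecidableEq ι]
    (hmax : ∀ i ∈ X, r i < r n) (h : v n ∉ N) (hS : S ⊆ X) :
    IsNbc v w r N (insert n X) (insert n S) ↔
      IsNbc v w r (N ⊔ Submodule.span F {v n}) X S := by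
  have he : {s | s ∈ insert n S ∧ r n < r s} = ∅ := by
    ext s
    simpa using fun hs : s = n ∨ s ∈ S =>
      hs.elim (fun e => (congr_arg r e).le) fun hs => (hmax s (hS hs)).le
  have hi : ∀ i ∈ X, {s | s ∈ insert n S ∧ r i < r s} = insert n {s | s ∈ S ∧ r i < r s} := by
    intro i hi
    ext s
    simp only [Finset.mem_insert, Set.mem_ofPred_eq, Set.mem_insert_iff]
    constructor
    · rintro ⟨rfl | h, h'⟩
      · exact Or.inl rfl
      · exact Or.inr ⟨h, h'⟩
    · rintro (rfl | h)
      · exact ⟨Or.inl rfl, hmax i hi⟩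
      · exact ⟨Or.inr h.1, h.2⟩
  unfold IsNbc
  rw [Finset.forall_mem_insert, he]
  simp only [Set.image_empty, Submodule.span_empty, sup_bot_eq, h, not_false_eq_true, true_and,
    Finset.coe_insert, Set.image_insert_eq, Submodule.span_insert, sup_assoc]
  refine and_congr (forall₂_congr fun i hiX => ?_) Iff.rfl
  rw [hi i hiX, Set.image_insert_eq, Submodule.span_insert]

/-- Deletion-contraction for the last element: sets avoiding n are those of the deletion, sets
containing n are those of the contraction with one more element, whence the minus sign. -/
lemma nbcSum_insert {N : Submodule F U} {X : Finset ι} {n : ι} [DecidableEq ι]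
    (hmax : ∀ i ∈ X, r i < r n) (h : v n ∉ N) :
    nbcSum v w r N (insert n X) =
      nbcSum v w r N X - nbcSum v w r (N ⊔ Submodule.span F {v n}) X := by
  have hn : n ∉ X := fun hn => (hmax n hn).false
  have h1 := Finset.sum_powerset_insert hn fun S =>
    open Classical in if IsNbc v w r N (insert n X) S then (-1 : ℤ) ^ S.card else 0
  unfold nbcSum
  rw [sub_eq_add_neg, ← Finset.sum_neg_distrib]
  classical
  refine h1.trans (congr_arg₂ _ ?_ ?_)
  · refine Finset.sum_congr rfl fun S hS => ?_
    exact if_congr (isNbc_insert_of_subset hmax h (Finset.mem_powerset.mp hS)) rfl rfl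
  · refine Finset.sum_congr rfl fun S hS => ?_
    rw [Finset.mem_powerset] at hS
    refine (if_congr (isNbc_insert_insert hmax h hS) rfl rfl).trans ?_
    rw [Finset.card_insert_of_notMem fun hnS => hn (hS hnS)]
    split_ifs <;> simp [pow_succ]

lemma mem_sup_span_singleton_iff {P R : Submodule F U} {x u : U} (hPR : P ≤ R) (hx : x ∉ R)
    (hu : u ∈ R) : u ∈ P ⊔ Submodule.span F {x} ↔ u ∈ P := by
  refine ⟨fun h => ?_, fun h => Submodule.mem_sup_left h⟩
  obtain ⟨p, hp, y, hy, rfl⟩ := Submodule.mem_sup.mp h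
  obtain ⟨c, rfl⟩ := Submodule.mem_span_singleton.mp hy
  have hc : c • x ∈ R := (Submodule.add_mem_iff_right _ (hPR hp)).mp hu
  have : c = 0 := by
    by_contra hc0
    exact hx ((Submodule.smul_mem_iff _ hc0).mp hc)
  simpa [this] using hp

/-- Every membership tested by `IsNbc` concerns subspaces and vectors inside the closure, so a
vector outside it cannot affect the answer. -/
lemma nbcSum_sup_eq {N : Submodule F U} {X : Finset ι} {x : U}
    (hx : x ∉ closure v w N (X : Set ι)) :
    nbcSum v w r (N ⊔ Submodule.span F {x}) X = nbcSum v w r N X := by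
  have hv : ∀ i ∈ X, v i ∈ closure v w N (X : Set ι) := fun i hi =>
    Submodule.mem_sup_right (Submodule.subset_span ⟨i, hi, rfl⟩)
  have hw : w ∈ closure v w N (X : Set ι) :=
    Submodule.mem_sup_left (Submodule.mem_sup_right (Submodule.mem_span_singleton_self w))
  refine Finset.sum_congr rfl fun S hS => ?_
  rw [Finset.mem_powerset] at hS
  have hle : ∀ T : Set ι, T ⊆ X →
      N ⊔ Submodule.span F (v '' T) ≤ closure v w N (X : Set ι) := fun T hT =>
    sup_le (le_sup_left.trans le_sup_left)
      ((Submodule.span_mono (Set.image_mono hT)).trans le_sup_right)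
  have : IsNbc v w r (N ⊔ Submodule.span F {x}) X S ↔ IsNbc v w r N X S := by
    unfold IsNbc
    simp only [sup_right_comm N (Submodule.span F {x})]
    rw [mem_sup_span_singleton_iff (hle _ (by exact_mod_cast hS)) hx hw]
    refine and_congr (forall₂_congr fun i hi => ?_) Iff.rfl
    rw [mem_sup_span_singleton_iff (hle _ fun s hs => hS hs.1) hx (hv i hi)]
  classical exact if_congr this rfl rfl

lemma le_closure (N : Submodule F U) (X : Set ι) : N ≤ closure v w N X :=
  le_sup_left.trans le_sup_left

lemma closure_sup_span (N : Submodule F U) (X Y : Set ι) :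
    closure v w N X ⊔ (N ⊔ Submodule.span F (v '' Y)) = closure v w N (X ∪ Y) := by
  unfold closure
  rw [Set.image_union, Submodule.span_union]
  apply le_antisymm
  · refine sup_le (sup_le le_sup_left (le_sup_left.trans le_sup_right))
      (sup_le (le_sup_left.trans le_sup_left) (le_sup_right.trans le_sup_right))
  · refine sup_le (le_sup_left.trans le_sup_left) (sup_le (le_sup_right.trans le_sup_left)
      (le_sup_right.trans le_sup_right))

lemma closure_mono {N N' : Submodule F U} {X Y : Set ι} (hN : N ≤ N') (h : X ⊆ Y) :
    closure v w N X ≤ closure v w N' Y :=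
  sup_le_sup (sup_le_sup_right hN _) (Submodule.span_mono (Set.image_mono h))

lemma closure_insert (N : Submodule F U) (X : Set ι) (n : ι) :
    closure v w N (insert n X) = closure v w (N ⊔ Submodule.span F {v n}) X := by
  unfold closure
  rw [Set.image_insert_eq, Submodule.span_insert]
  ac_rfl

lemma closure_sup_of_mem {N : Submodule F U} {X : Set ι} {x : U} (hx : x ∈ closure v w N X) :
    closure v w (N ⊔ Submodule.span F {x}) X = closure v w N X := by
  apply le_antisymm
  · refine sup_le (sup_le (sup_le (le_closure _ _) ?_) (le_sup_right.trans le_sup_left)) le_sup_right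
    exact (Submodule.span_singleton_le_iff_mem _ _).mpr hx
  · exact closure_mono le_sup_left subset_rfl

lemma IsConn.notMem {N : Submodule F U} {X : Finset ι} (h : IsConn v w N X) {n : ι} (hn : n ∈ X) :
    v n ∉ N := by
  intro hv
  refine h.2 {n} (by simpa using hn) (Finset.singleton_nonempty n) (inf_le_right.trans ?_)
  simpa [Submodule.span_singleton_le_iff_mem] using hv

/-- A connected configuration has no coloop: otherwise {n} would split off. -/
lemma IsConn.mem_closure [DecidableEq ι] {N : Submodule F U} {X : Finset ι} {n : ι} (hn : n ∉ X)
    (h : IsConn v w N (insert n X)) : v n ∈ closure v w N (X : Set ι) := by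
  by_contra hv
  refine h.2 {n} (by simp) (Finset.singleton_nonempty n) ?_
  have he : ((insert n X : Finset ι) : Set ι) \ (({n} : Finset ι) : Set ι) = X := by
    ext i
    simp only [Finset.coe_insert, Finset.coe_singleton, Set.mem_sdiff, Set.mem_insert_iff,
      Finset.mem_coe, Set.mem_singleton_iff]
    constructor
    · rintro ⟨rfl | h1, h2⟩
      · exact absurd rfl h2
      · exact h1
    · exact fun hi => ⟨Or.inr hi, fun e => hn (e ▸ hi)⟩
  rw [he]
  rintro y ⟨hy1, hy2⟩
  simp only [Finset.coe_singleton, Set.image_singleton] at hy2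
  exact (mem_sup_span_singleton_iff (le_closure _ _) hv hy1).mp hy2

end BrokenCircuits

/-! ### Connectedness and positivity of the beta invariant. -/

section Connectivity

variable {F U ι : Type*} [Field F] [AddCommGroup U] [Module F U] [FiniteDimensional F U]
  {v : ι → U} {w : U} {r : ι → ℕ}

lemma finrank_sup_span_singleton {N : Submodule F U} {x : U} (hx : x ∉ N) :
    finrank F ↥(N ⊔ Submodule.span F {x}) = finrank F N + 1 := by
  have h := Submodule.finrank_sup_add_finrank_inf_eq N (Submodule.span F {x})
  have hx0 : x ≠ 0 := fun h0 => hx (h0 ▸ N.zero_mem)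
  have hd : N ⊓ Submodule.span F {x} = ⊥ :=
    (Submodule.disjoint_span_singleton' hx0).mpr hx |>.eq_bot
  rw [hd, finrank_bot, finrank_span_singleton hx0] at h
  exact h

/-- Connectedness in terms of ranks: a nontrivial separation has excess rank. -/
lemma finrank_add_of_not_inf_le {N A B : Submodule F U} (hA : N ≤ A) (hB : N ≤ B)
    (h : ¬ A ⊓ B ≤ N) :
    finrank F ↥(A ⊔ B) + finrank F N + 1 ≤ finrank F A + finrank F B := by
  have h1 := Submodule.finrank_sup_add_finrank_inf_eq A B
  have h2 : N < A ⊓ B := lt_of_le_not_ge (le_inf hA hB) h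
  have := Submodule.finrank_lt_finrank_of_lt h2
  omega

lemma finrank_add_of_inf_le {N A B : Submodule F U} (h : A ⊓ B ≤ N) :
    finrank F A + finrank F B ≤ finrank F ↥(A ⊔ B) + finrank F N := by
  have h1 := Submodule.finrank_sup_add_finrank_inf_eq A B
  have := Submodule.finrank_mono h
  omega

/-- Deleting or contracting an element keeps a connected configuration connected. -/
lemma IsConn.delete_or_contract [DecidableEq ι] {N : Submodule F U} {X : Finset ι} {n : ι}
    (hn : n ∉ X) (h : IsConn v w N (insert n X)) :
    IsConn v w N X ∨ IsConn v w (N ⊔ Submodule.span F {v n}) X := by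
  have hnN := h.notMem (Finset.mem_insert_self n X)
  have hnR := h.mem_closure hn
  set N' := N ⊔ Submodule.span F {v n} with hN'
  have hrk : finrank F N' = finrank F N + 1 := finrank_sup_span_singleton hnN
  set R := closure v w N (X : Set ι) with hR
  have hRn : closure v w N (insert n (X : Set ι)) = R := by
    rw [closure_insert, closure_sup_of_mem hnR]
  have hRN' : closure v w N' (X : Set ι) = R := closure_sup_of_mem hnR
  by_contra hcon
  rw [not_or] at hcon
  obtain ⟨Y₁, hY₁, hne₁, hle₁⟩ : ∃ Y ⊆ X, Y.Nonempty ∧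
      closure v w N (X \ Y : Set ι) ⊓ (N ⊔ Submodule.span F (v '' (Y : Set ι))) ≤ N := by
    have := hcon.1
    simp only [IsConn, not_and, not_forall, not_not] at this
    obtain ⟨Y, h1, h2, h3⟩ := this h.1
    exact ⟨Y, h1, h2, h3⟩
  obtain ⟨Y₂, hY₂, hne₂, hle₂⟩ : ∃ Y ⊆ X, Y.Nonempty ∧
      closure v w N' (X \ Y : Set ι) ⊓ (N' ⊔ Submodule.span F (v '' (Y : Set ι))) ≤ N' := by
    -- If w becomes a loop in the contraction, Y₂ = X serves as a degenerate separation with the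
    -- same rank bound.
    by_cases hw : w ∈ N'
    · refine ⟨X, subset_rfl, hne₁.mono hY₁, inf_le_left.trans ?_⟩
      simpa [closure, Submodule.span_singleton_le_iff_mem] using hw
    · have := hcon.2
      simp only [IsConn, not_and, not_forall, not_not] at this
      obtain ⟨Y, h1, h2, h3⟩ := this hw
      exact ⟨Y, h1, h2, h3⟩
  have hun : ∀ Y : Finset ι, Y ⊆ X → (X \ Y : Set ι) ∪ Y = X := fun Y hY =>
    Set.sdiff_union_of_subset (by exact_mod_cast hY)
  -- The two separations together have rank sum at most 2(rk R + rk N) + 1, the extra 1 coming from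
  -- rk N' = rk N + 1. By `key` two nontrivial separations of the whole configuration need at least
  -- 2(rk R + rk N) + 2, and submodularity of rank will produce such pairs.
  have d₁ := finrank_add_of_inf_le hle₁
  have d₂ := finrank_add_of_inf_le hle₂
  rw [closure_sup_span, hun Y₁ hY₁, ← hR] at d₁
  rw [closure_sup_span, hun Y₂ hY₂, hRN'] at d₂
  -- lower bounds for ranks of separations of the connected configuration
  have key : ∀ Y ⊆ insert n X, Y.Nonempty → ∀ A B : Submodule F U,
      closure v w N ((insert n X : Finset ι) \ Y : Set ι) ≤ A →
      N ⊔ Submodule.span F (v '' (Y : Set ι)) ≤ B →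
      finrank F R + finrank F N + 1 ≤ finrank F A + finrank F B := by
    intro Y hY hne A B hA hB
    have h1 := finrank_add_of_not_inf_le (le_closure _ _) le_sup_left (h.2 Y hY hne)
    rw [closure_sup_span, Set.sdiff_union_of_subset (by exact_mod_cast hY), Finset.coe_insert,
      hRn, ← Finset.coe_insert] at h1
    have h2 := Submodule.finrank_mono hA
    have h3 := Submodule.finrank_mono hB
    omega
  have sub : ∀ A B : Submodule F U,
      finrank F ↥(A ⊔ B) + finrank F ↥(A ⊓ B) = finrank F A + finrank F B :=
    fun A B => Submodule.finrank_sup_add_finrank_inf_eq A B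
  set a₁ := closure v w N (X \ Y₁ : Set ι)
  set b₁ := N ⊔ Submodule.span F (v '' (Y₁ : Set ι)) with hb₁
  set a₂ := closure v w N' (X \ Y₂ : Set ι) with ha₂
  set b₂ := N' ⊔ Submodule.span F (v '' (Y₂ : Set ι)) with hb₂
  have hvb₂ : ∀ i ∈ insert n Y₂, v i ∈ b₂ := by
    intro i hi
    rcases Finset.mem_insert.mp hi with rfl | hi
    · exact Submodule.mem_sup_left (Submodule.mem_sup_right (Submodule.mem_span_singleton_self _))
    · exact Submodule.mem_sup_right (Submodule.subset_span ⟨i, hi, rfl⟩)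
  have hvb₁ : ∀ i ∈ Y₁, v i ∈ b₁ := fun i hi =>
    Submodule.mem_sup_right (Submodule.subset_span ⟨i, hi, rfl⟩)
  have hva₁ : ∀ i ∈ X, i ∉ Y₁ → v i ∈ a₁ := fun i hi hi' =>
    Submodule.mem_sup_right (Submodule.subset_span ⟨i, ⟨hi, hi'⟩, rfl⟩)
  have hva₂ : ∀ i ∈ insert n X, i ∉ Y₂ → v i ∈ a₂ := by
    intro i hi hi'
    rcases Finset.mem_insert.mp hi with rfl | hi
    · exact le_closure _ _ (Submodule.mem_sup_right (Submodule.mem_span_singleton_self _))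
    · exact Submodule.mem_sup_right (Submodule.subset_span ⟨i, ⟨hi, hi'⟩, rfl⟩)
  have hNa₁ : N ≤ a₁ := le_closure _ _
  have hNa₂ : N ≤ a₂ := le_sup_left.trans (le_closure _ _)
  have hNb₁ : N ≤ b₁ := le_sup_left
  have hNb₂ : N ≤ b₂ := le_sup_left.trans le_sup_left
  have hwa₁ : w ∈ a₁ :=
    Submodule.mem_sup_left (Submodule.mem_sup_right (Submodule.mem_span_singleton_self w))
  have hwa₂ : w ∈ a₂ :=
    Submodule.mem_sup_left (Submodule.mem_sup_right (Submodule.mem_span_singleton_self w))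
  have hcl : ∀ (Y : Finset ι) (A : Submodule F U), N ≤ A → w ∈ A →
      (∀ i ∈ insert n X, i ∉ Y → v i ∈ A) →
      closure v w N ((insert n X : Finset ι) \ Y : Set ι) ≤ A := by
    intro Y A h1 h2 h3
    refine sup_le (sup_le h1 ((Submodule.span_singleton_le_iff_mem _ _).mpr h2))
      (Submodule.span_le.mpr ?_)
    rintro _ ⟨i, ⟨hi, hi'⟩, rfl⟩
    exact h3 i hi hi'
  have hsp : ∀ (Y : Finset ι) (A : Submodule F U), N ≤ A → (∀ i ∈ Y, v i ∈ A) →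
      N ⊔ Submodule.span F (v '' (Y : Set ι)) ≤ A := by
    intro Y A h1 h2
    refine sup_le h1 (Submodule.span_le.mpr ?_)
    rintro _ ⟨i, hi, rfl⟩
    exact h2 i hi
  -- Uncrossing by intersection and union. The vector of n lies in both a₂ and b₂, so n may be
  -- placed on either side.
  have c1 : ¬ (Y₁ ∩ Y₂).Nonempty := by
    intro hne
    have k1 := key (Y₁ ∩ Y₂) (Finset.inter_subset_left.trans (hY₁.trans (Finset.subset_insert _ _)))
      hne (a₁ ⊔ a₂) (b₁ ⊓ b₂)
      (hcl _ _ (hNa₁.trans le_sup_left) (Submodule.mem_sup_left hwa₁) (by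
        intro i hi hi'
        by_cases h2 : i ∈ Y₂
        · have hi1 : i ∉ Y₁ := fun h1 => hi' (Finset.mem_inter.mpr ⟨h1, h2⟩)
          exact Submodule.mem_sup_left (hva₁ i (hY₂ h2) hi1)
        · exact Submodule.mem_sup_right (hva₂ i hi h2)))
      (hsp _ _ (le_inf hNb₁ hNb₂) (by
        intro i hi
        rw [Finset.mem_inter] at hi
        exact ⟨hvb₁ i hi.1, hvb₂ i (Finset.mem_insert_of_mem hi.2)⟩))
    have k2 := key (insert n (Y₁ ∪ Y₂)) (Finset.insert_subset_insert _ (Finset.union_subset hY₁ hY₂))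
      (Finset.insert_nonempty _ _) (a₁ ⊓ a₂) (b₁ ⊔ b₂)
      (hcl _ _ (le_inf hNa₁ hNa₂) ⟨hwa₁, hwa₂⟩ (by
        intro i hi hi'
        simp only [Finset.mem_insert, Finset.mem_union, not_or] at hi'
        exact ⟨hva₁ i (Finset.mem_of_mem_insert_of_ne hi hi'.1) hi'.2.1, hva₂ i hi hi'.2.2⟩))
      (hsp _ _ (hNb₁.trans le_sup_left) (by
        intro i hi
        simp only [Finset.mem_insert, Finset.mem_union] at hi
        rcases hi with h | h | h
        · exact Submodule.mem_sup_right (hvb₂ i (by simp [h]))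
        · exact Submodule.mem_sup_left (hvb₁ i h)
        · exact Submodule.mem_sup_right (hvb₂ i (by simp [h]))))
    have := sub a₁ a₂
    have := sub b₁ b₂
    omega
  -- Uncrossing by the two differences; w lies in both a₁ and a₂, hence always on the required side.
  have c2 : ¬ ((Y₂ \ Y₁).Nonempty ∧ (Y₁ \ Y₂).Nonempty) := by
    rintro ⟨hne, hne'⟩
    have k1 := key (Y₂ \ Y₁) (Finset.sdiff_subset.trans (hY₂.trans (Finset.subset_insert _ _)))
      hne (b₁ ⊔ a₂) (a₁ ⊓ b₂)
      (hcl _ _ (hNb₁.trans le_sup_left) (Submodule.mem_sup_right hwa₂) (by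
        intro i hi hi'
        by_cases h2 : i ∈ Y₂
        · have hi1 : i ∈ Y₁ := by
            by_contra h1
            exact hi' (Finset.mem_sdiff.mpr ⟨h2, h1⟩)
          exact Submodule.mem_sup_left (hvb₁ i hi1)
        · exact Submodule.mem_sup_right (hva₂ i hi h2)))
      (hsp _ _ (le_inf hNa₁ hNb₂) (by
        intro i hi
        rw [Finset.mem_sdiff] at hi
        exact ⟨hva₁ i (hY₂ hi.1) hi.2, hvb₂ i (Finset.mem_insert_of_mem hi.1)⟩))
    have k2 := key (Y₁ \ Y₂) (Finset.sdiff_subset.trans (hY₁.trans (Finset.subset_insert _ _)))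
      hne' (a₁ ⊔ b₂) (b₁ ⊓ a₂)
      (hcl _ _ (hNa₁.trans le_sup_left) (Submodule.mem_sup_left hwa₁) (by
        intro i hi hi'
        by_cases h2 : i ∈ insert n Y₂
        · exact Submodule.mem_sup_right (hvb₂ i h2)
        · simp only [Finset.mem_insert, not_or] at h2
          have hi1 : i ∉ Y₁ := fun h1 => hi' (Finset.mem_sdiff.mpr ⟨h1, h2.2⟩)
          exact Submodule.mem_sup_left (hva₁ i (Finset.mem_of_mem_insert_of_ne hi h2.1) hi1)))
      (hsp _ _ (le_inf hNb₁ hNa₂) (by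
        intro i hi
        rw [Finset.mem_sdiff] at hi
        exact ⟨hvb₁ i hi.1, hva₂ i (Finset.mem_insert_of_mem (hY₁ hi.1)) hi.2⟩))
    have := sub b₁ a₂
    have := sub a₁ b₂
    omega
  obtain ⟨i, hi⟩ := hne₁
  obtain ⟨j, hj⟩ := hne₂
  exact c2 ⟨⟨j, Finset.mem_sdiff.mpr ⟨hj, fun h1 => c1 ⟨j, Finset.mem_inter.mpr ⟨h1, hj⟩⟩⟩⟩,
    ⟨i, Finset.mem_sdiff.mpr ⟨hi, fun h1 => c1 ⟨i, Finset.mem_inter.mpr ⟨hi, h1⟩⟩⟩⟩⟩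

/-- Crapo's theorem: the beta invariant is nonnegative, and positive for a connected
configuration. -/
lemma nbcSum_sign (hr : Function.Injective r) (X : Finset ι) (N : Submodule F U) :
    0 ≤ (-1) ^ (finrank F (closure v w N (X : Set ι)) + finrank F N + 1) * nbcSum v w r N X ∧
      (IsConn v w N X →
        0 < (-1) ^ (finrank F (closure v w N (X : Set ι)) + finrank F N + 1) *
          nbcSum v w r N X) := by
  classical
  induction X using Finset.induction_on_max_value r generalizing N with
  | empty =>
    by_cases hw : w ∈ N
    · simp [nbcSum_empty_of_mem hw, IsConn, hw]
    · have h1 : closure v w N ((∅ : Finset ι) : Set ι) = N ⊔ Submodule.span F {w} := by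
        simp [closure]
      rw [h1, finrank_sup_span_singleton hw, nbcSum_empty hw]
      have : Even (finrank F N + 1 + finrank F N + 1) := ⟨finrank F N + 1, by ring⟩
      simp [this.neg_one_pow]
  | insert n X hn hmax ih =>
    have hlt : ∀ i ∈ X, r i < r n := fun i hi =>
      lt_of_le_of_ne (hmax i hi) fun e => hn (hr e ▸ hi)
    by_cases hnN : v n ∈ N
    · rw [nbcSum_eq_zero_of_mem (Finset.mem_insert_self n X) hnN]
      exact ⟨by simp, fun h => absurd hnN (h.notMem (Finset.mem_insert_self n X))⟩
    · rw [nbcSum_insert hlt hnN]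
      by_cases hnR : v n ∈ closure v w N (X : Set ι)
      · have e1 : closure v w N ((insert n X : Finset ι) : Set ι) = closure v w N (X : Set ι) := by
          rw [Finset.coe_insert, closure_insert, closure_sup_of_mem hnR]
        have i1 := ih N
        have i2 := ih (N ⊔ Submodule.span F {v n})
        rw [closure_sup_of_mem hnR, finrank_sup_span_singleton hnN] at i2
        rw [e1]
        set A := (-1 : ℤ) ^ (finrank F (closure v w N (X : Set ι)) + finrank F N + 1) with hA
        -- Contraction lowers the relative rank by one. This sign change cancels the minus in
        -- deletion-contraction, so two nonnegative terms are added.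
        have e2 : (-1 : ℤ) ^
            (finrank F (closure v w N (X : Set ι)) + (finrank F N + 1) + 1) = -A := by
          rw [hA, ← add_assoc, pow_succ _ (_ + 1)]; ring
        rw [e2] at i2
        refine ⟨by linarith [i1.1, i2.1], fun h => ?_⟩
        rcases h.delete_or_contract hn with h | h
        · linarith [i1.2 h, i2.1]
        · linarith [i1.1, i2.2 h]
      -- Here n is a coloop: deletion and contraction have equal counts, and the difference is zero.
      · rw [nbcSum_sup_eq hnR]
        exact ⟨by simp, fun h => absurd (h.mem_closure hn) hnR⟩

lemma nbcSum_ne_zero (hr : Function.Injective r) {X : Finset ι} {N : Submodule F U}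
    (h : IsConn v w N X) : nbcSum v w r N X ≠ 0 := by
  intro h0
  have := (nbcSum_sign (r := r) hr X N).2 h
  simp [h0] at this

end Connectivity

end OrlikSolomon

namespace OrlikSolomon

/-! ### Levels in the flag of a set without broken circuits. -/

section Level

variable {F U ι : Type*} [Field F] [AddCommGroup U] [Module F U] (v : ι → U) (r : ι → ℕ)
  (S : Finset ι)

/-- The flag of subspaces spanned by the final segments of `S`. -/
def levelSpan (k : ℕ) : Submodule F U := Submodule.span F (v '' {s | s ∈ S ∧ k ≤ r s})

variable (F) in
/-- The position of `v i` in the flag of subspaces spanned by the final segments of `S`. -/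
noncomputable def level (i : ι) : ℕ := sInf {k | v i ∉ levelSpan (F := F) v r S k}

variable {v r S} {w : U} [Fintype ι]

lemma IsNbc.notMem_levelSpan (h : IsNbc v w r (⊥ : Submodule F U) Finset.univ S) (i : ι) :
    v i ∉ levelSpan (F := F) v r S (r i + 1) := by
  have := h.1 i (Finset.mem_univ i)
  rwa [bot_sup_eq] at this

lemma IsNbc.level_le (h : IsNbc v w r (⊥ : Submodule F U) Finset.univ S) (i : ι) :
    level F v r S i ≤ r i + 1 :=
  Nat.sInf_le (h.notMem_levelSpan i)

lemma IsNbc.notMem_level (h : IsNbc v w r (⊥ : Submodule F U) Finset.univ S) (i : ι) :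
    v i ∉ levelSpan (F := F) v r S (level F v r S i) :=
  Nat.sInf_mem (s := {k | v i ∉ levelSpan (F := F) v r S k}) ⟨_, h.notMem_levelSpan i⟩

omit [Fintype ι] in
lemma mem_levelSpan_of_lt {i : ι} {k : ℕ} (h : k < level F v r S i) :
    v i ∈ levelSpan (F := F) v r S k := by
  by_contra h'
  exact Nat.notMem_of_lt_sInf h h'

lemma IsNbc.level_of_mem (h : IsNbc v w r (⊥ : Submodule F U) Finset.univ S) {s : ι}
    (hs : s ∈ S) : level F v r S s = r s + 1 := by
  refine le_antisymm (h.level_le s) ?_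
  by_contra hlt
  exact h.notMem_level s (Submodule.subset_span ⟨s, ⟨hs, by omega⟩, rfl⟩)

/-- If the levels were distinct, an element c of least level would be in the span of elements of
higher level, all of which lie in the flag step at the level of c; but v c does not. -/
lemma IsNbc.not_nodup_level (h : IsNbc v w r (⊥ : Submodule F U) Finset.univ S) {l : List ι}
    (hne : l ≠ []) (hl : ∀ c ∈ l, v c ∈ Submodule.span F (v '' {d | d ∈ l ∧ d ≠ c})) :
    ¬ (l.map (level F v r S)).Nodup := by
  classical
  intro hnd
  obtain ⟨c, hc, hmin⟩ := l.toFinset.exists_min_image (level F v r S)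
    (List.toFinset_nonempty_iff l |>.mpr hne)
  simp only [List.mem_toFinset] at hc hmin
  refine h.notMem_level c (Submodule.span_le.mpr ?_ (hl c hc))
  rintro _ ⟨d, ⟨hd, hdc⟩, rfl⟩
  refine mem_levelSpan_of_lt (lt_of_le_of_ne (hmin d hd) fun e => hdc ?_)
  exact (List.inj_on_of_nodup_map hnd hc hd e).symm

lemma IsNbc.exists_level_eq_zero (h : IsNbc v w r (⊥ : Submodule F U) Finset.univ S) {l : List ι}
    (hl : w ∈ Submodule.span F (v '' {i | i ∈ l})) : ∃ c ∈ l, level F v r S c = 0 := by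
  by_contra! hcon
  have hw := h.2
  rw [bot_sup_eq] at hw
  refine hw (Submodule.span_le.mpr ?_ hl)
  rintro _ ⟨c, hc, rfl⟩
  have := mem_levelSpan_of_lt (Nat.pos_of_ne_zero (hcon c hc))
  refine Submodule.span_mono (Set.image_mono ?_) this
  exact fun s hs => hs.1

/-- Descending along S, each s is shown to be in T. Some i in T has level r s + 1, so r s ≤ r i. If
i were not s, exchange would put v s in the span of elements of T larger than s, a broken circuit in
T. -/
lemma IsNbc.eq_of_perm (hr : Function.Injective r)
    (h : IsNbc v w r (⊥ : Submodule F U) Finset.univ S) {T : Finset ι}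
    (hT : IsNbc v w r (⊥ : Submodule F U) Finset.univ T)
    (hp : (T.toList.map (level F v r S)).Perm (S.toList.map fun s => r s + 1)) : T = S := by
  have hsub : ∀ n, ∀ s ∈ S, S.sup r - r s = n → s ∈ T := by
    intro n
    induction n using Nat.strong_induction_on with
    | _ n ih =>
      intro s hs hsn
      have hgt : ∀ t ∈ S, r s < r t → t ∈ T := fun t ht hst => by
        have h1 : r t ≤ S.sup r := Finset.le_sup ht
        exact ih (S.sup r - r t) (by omega) t ht rfl
      have hmem : r s + 1 ∈ T.toList.map (level F v r S) :=
        hp.mem_iff.mpr (List.mem_map.mpr ⟨s, Finset.mem_toList.mpr hs, rfl⟩)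
      obtain ⟨i, hi, hlev⟩ := List.mem_map.mp hmem
      rw [Finset.mem_toList] at hi
      have hle := h.level_le i
      by_cases hri : r i = r s
      · exact hr hri ▸ hi
      exfalso
      have h1 : v i ∈ levelSpan (F := F) v r S (r s) := mem_levelSpan_of_lt (by omega)
      have h2 : v i ∉ levelSpan (F := F) v r S (r s + 1) := hlev ▸ h.notMem_level i
      have hset : {t | t ∈ S ∧ r s ≤ r t} = insert s {t | t ∈ S ∧ r s + 1 ≤ r t} := by
        ext t
        simp only [Set.mem_ofPred_eq, Set.mem_insert_iff]
        constructor
        · rintro ⟨ht, hst⟩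
          rcases hst.eq_or_lt with e | e
          · exact Or.inl (hr e).symm
          · exact Or.inr ⟨ht, e⟩
        · rintro (rfl | ⟨ht, hst⟩)
          · exact ⟨hs, le_rfl⟩
          · exact ⟨ht, by omega⟩
      rw [levelSpan, hset, Set.image_insert_eq] at h1
      have h3 := mem_span_insert_exchange h1 h2
      have hs' := hT.notMem_levelSpan s
      refine hs' (Submodule.span_mono ?_ h3)
      rw [← Set.image_insert_eq]
      apply Set.image_mono
      rintro t (rfl | ⟨ht, hst⟩)
      · exact ⟨hi, by omega⟩
      · exact ⟨hgt t ht hst, hst⟩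
  have hcard : T.card = S.card := by simpa using hp.length_eq
  exact (Finset.eq_of_subset_of_card_le (fun s hs => hsub _ s hs rfl) hcard.le).symm

end Level

/-! ### Forms dual to the monomials without broken circuits. -/

section Dual

variable (K : Type*) [Field K] {F U ι : Type*} [Field F] [AddCommGroup U] [Module F U]

/-- The linear endomorphism killing the basis vector with index `0`. -/
noncomputable def killZero : (ℕ →₀ K) →ₗ[K] (ℕ →₀ K) :=
  Finsupp.linearCombination K fun k => if k = 0 then 0 else Finsupp.single k 1

variable {K} in
lemma map_killZero_of_mem {l : List ℕ} (h : 0 ∈ l) :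
    ExteriorAlgebra.map (killZero K) (mono K l) = 0 := by
  induction l with
  | nil => simp at h
  | cons a l ih =>
    rw [mono_cons, map_mul, ExteriorAlgebra.map_apply_ι]
    rcases List.mem_cons.mp h with rfl | h
    · simp [killZero]
    · rw [ih h, mul_zero]

variable {K} in
lemma map_killZero_of_notMem {l : List ℕ} (h : 0 ∉ l) :
    ExteriorAlgebra.map (killZero K) (mono K l) = mono K l := by
  induction l with
  | nil => simp
  | cons a l ih =>
    simp only [List.mem_cons, not_or] at h
    rw [mono_cons, map_mul, ExteriorAlgebra.map_apply_ι, ih h.2]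
    simp [killZero, Ne.symm h.1]

variable (F) in
/-- The algebra map sending each `e_i` to the basis vector recording the position of `v i` in the
flag of subspaces spanned by the final segments of `S`, or to zero outside the span of `S`. -/
noncomputable def levelHom (v : ι → U) (r : ι → ℕ) (S : Finset ι) :
    ExteriorAlgebra K (ι →₀ K) →ₐ[K] ExteriorAlgebra K (ℕ →₀ K) :=
  (ExteriorAlgebra.map (killZero K)).comp
    (ExteriorAlgebra.map (Finsupp.lmapDomain K K (level F v r S)))

variable {K} {v : ι → U} {w : U} {r : ι → ℕ} {S : Finset ι}

lemma levelHom_mono (l : List ι) : levelHom K F v r S (mono K l) =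
    ExteriorAlgebra.map (killZero K) (mono K (l.map (level F v r S))) := by
  rw [levelHom, AlgHom.comp_apply, map_mono _ (level F v r S) (by simp)]

/-- Relabelling by levels preserves the coordinate sum, so it commutes with contraction. Killing
index 0 does not preserve it, and therefore stays outside. -/
lemma levelHom_contract_mono (l : List ι) :
    levelHom K F v r S (contract (coordSum K ι) (mono K l)) =
      ExteriorAlgebra.map (killZero K)
        (contract (coordSum K ℕ) (mono K (l.map (level F v r S)))) := by
  have h : coordSum K ι = coordSum K ℕ ∘ₗ Finsupp.lmapDomain K K (level F v r S) := by
    ext i; simp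
  rw [levelHom, AlgHom.comp_apply, h, map_contract, map_mono _ (level F v r S) (by simp)]

variable [Fintype ι]

lemma IsNbc.levelHom_contract_eq_zero (h : IsNbc v w r (⊥ : Submodule F U) Finset.univ S)
    {l : List ι} (hl : ∀ c ∈ l, v c ∈ Submodule.span F (v '' {d | d ∈ l ∧ d ≠ c})) :
    levelHom K F v r S (contract (coordSum K ι) (mono K l)) = 0 := by
  rcases eq_or_ne l [] with rfl | hne
  · simp
  · rw [levelHom_contract_mono, mono_eq_zero (h.not_nodup_level hne hl), map_zero, map_zero]

lemma IsNbc.levelHom_mono_eq_zero (h : IsNbc v w r (⊥ : Submodule F U) Finset.univ S)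
    {l : List ι} (hl : w ∈ Submodule.span F (v '' {i | i ∈ l})) :
    levelHom K F v r S (mono K l) = 0 := by
  obtain ⟨c, hc, h0⟩ := h.exists_level_eq_zero hl
  rw [levelHom_mono, map_killZero_of_mem (List.mem_map.mpr ⟨c, hc, h0⟩)]

variable (K F v r S) in
/-- The linear form dual to the monomial of a set without broken circuits. -/
noncomputable def dualForm : ExteriorAlgebra K (ι →₀ K) →ₗ[K] K :=
  coeff (S.toList.map fun s => r s + 1) ∘ₗ (levelHom K F v r S).toLinearMap

lemma IsNbc.dualForm_self (hr : Function.Injective r)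
    (h : IsNbc v w r (⊥ : Submodule F U) Finset.univ S) :
    dualForm K F v r S (mono K S.toList) = 1 := by
  have he : S.toList.map (level F v r S) = S.toList.map fun s => r s + 1 :=
    List.map_congr_left fun s hs => h.level_of_mem (Finset.mem_toList.mp hs)
  rw [dualForm, LinearMap.comp_apply, AlgHom.toLinearMap_apply, levelHom_mono, he,
    map_killZero_of_notMem (by simp), coeff_self]
  exact S.nodup_toList.map fun a b hab => hr (by simpa using hab)

lemma IsNbc.dualForm_of_ne (hr : Function.Injective r)
    (h : IsNbc v w r (⊥ : Submodule F U) Finset.univ S) {T : Finset ι}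
    (hT : IsNbc v w r (⊥ : Submodule F U) Finset.univ T) (hne : T ≠ S) :
    dualForm K F v r S (mono K T.toList) = 0 := by
  rw [dualForm, LinearMap.comp_apply, AlgHom.toLinearMap_apply, levelHom_mono]
  by_cases h0 : 0 ∈ T.toList.map (level F v r S)
  · rw [map_killZero_of_mem h0, map_zero]
  · rw [map_killZero_of_notMem h0, coeff_of_not_perm fun hp => hne (h.eq_of_perm hr hT hp)]

end Dual

/-! ### Orlik–Solomon relations and straightening. -/

section Straightening

variable {K : Type*} [Field K] {F U ι : Type*} [Field F] [AddCommGroup U] [Module F U]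

/-- `J` is an ideal of Orlik–Solomon relations for the vectors `v i`, dehomogenized at `w`. -/
structure IsOrlikSolomon (v : ι → U) (w : U) (F : Type*) [Field F] [Module F U]
    (J : Submodule K (ExteriorAlgebra K (ι →₀ K))) : Prop where
  ι_mul_mem : ∀ x, ∀ y ∈ J, ExteriorAlgebra.ι K x * y ∈ J
  mul_ι_mem : ∀ x, ∀ y ∈ J, y * ExteriorAlgebra.ι K x ∈ J
  circuit : ∀ Y : Finset ι, ¬ LinearIndepOn F v (Y : Set ι) →
    w ∉ Submodule.span F (v '' (Y : Set ι)) →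
    ∃ l : List ι, l ≠ [] ∧ l.Nodup ∧ (∀ c ∈ l, c ∈ Y) ∧ contract (coordSum K ι) (mono K l) ∈ J
  monomial : ∀ l : List ι, l.Nodup → w ∈ Submodule.span F (v '' {i | i ∈ l}) → mono K l ∈ J
  -- The earlier fields make J large enough; this one keeps it from being too large. Testing against
  -- algebra maps avoids any choice of generators.
  map_eq_zero : ∀ Φ : ExteriorAlgebra K (ι →₀ K) →ₐ[K] ExteriorAlgebra K (ℕ →₀ K),
    (∀ l : List ι, (∀ c ∈ l, v c ∈ Submodule.span F (v '' {d | d ∈ l ∧ d ≠ c})) →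
      Φ (contract (coordSum K ι) (mono K l)) = 0) →
    (∀ l : List ι, w ∈ Submodule.span F (v '' {i | i ∈ l}) → Φ (mono K l) = 0) →
    ∀ y ∈ J, Φ y = 0

lemma mono_mem_of_contract_mem {J : Submodule K (ExteriorAlgebra K (ι →₀ K))}
    (hJ : ∀ x, ∀ y ∈ J, ExteriorAlgebra.ι K x * y ∈ J) {l : List ι} (hne : l ≠ [])
    (h : contract (coordSum K ι) (mono K l) ∈ J) : mono K l ∈ J := by
  cases l with
  | nil => exact absurd rfl hne
  | cons c l =>
    rw [mono_cons, contract_ι_mul] at h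
    have := hJ (Finsupp.single c 1) _ h
    rw [coordSum_single, one_smul, mul_sub, ← mul_assoc, ExteriorAlgebra.ι_sq_zero, zero_mul,
      sub_zero] at this
    rwa [mono_cons]

lemma mul_mono_mem {J : Submodule K (ExteriorAlgebra K (ι →₀ K))}
    (hJ : ∀ x, ∀ y ∈ J, y * ExteriorAlgebra.ι K x ∈ J) (l : List ι)
    {y : ExteriorAlgebra K (ι →₀ K)} (hy : y ∈ J) : y * mono K l ∈ J := by
  induction l generalizing y with
  | nil => simpa
  | cons i l ih => rw [mono_cons, ← mul_assoc]; exact ih (hJ _ _ hy)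

lemma mono_mem_of_subset {J : Submodule K (ExteriorAlgebra K (ι →₀ K))}
    (hJ : ∀ x, ∀ y ∈ J, y * ExteriorAlgebra.ι K x ∈ J) {l l' : List ι} (hl : l.Nodup)
    (hsub : l ⊆ l') (h : mono K l ∈ J) : mono K l' ∈ J := by
  obtain ⟨l₁, hp, hs⟩ := List.subperm_of_subset hl hsub
  obtain ⟨R, hR⟩ := hs.exists_perm_append
  replace hR := hR.trans (hp.append_right R)
  refine mono_mem_of_perm hR ?_
  rw [mono_append]
  exact mul_mono_mem hJ R h

variable {v : ι → U} {w : U} {r : ι → ℕ} [Fintype ι]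
  {J : Submodule K (ExteriorAlgebra K (ι →₀ K))}

/-- Straightening: monomials are combinations of monomials without broken circuits. -/
lemma IsOrlikSolomon.mono_mem (hJ : IsOrlikSolomon v w F J) (l : List ι) :
    mono K l ∈ J ⊔ Submodule.span K {y | ∃ S : Finset ι,
      IsNbc v w r (⊥ : Submodule F U) Finset.univ S ∧ S.card = l.length ∧
        y = mono K S.toList} := by
  classical
  generalize hm : (l.map r).sum = m
  induction m using Nat.strong_induction_on generalizing l with
  | _ m ih =>
  by_cases hl : l.Nodup
  swap
  · rw [mono_eq_zero hl]; exact zero_mem _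
  by_cases hw : w ∈ Submodule.span F (v '' {i | i ∈ l})
  · exact Submodule.mem_sup_left (hJ.monomial l hl hw)
  by_cases hnbc : IsNbc v w r (⊥ : Submodule F U) Finset.univ l.toFinset
  · refine Submodule.mem_sup_right (mono_mem_of_perm (List.toFinset_toList hl).symm
      (Submodule.subset_span ⟨_, hnbc, List.toFinset_card_of_nodup hl, rfl⟩))
  -- Since w is not in the span, failure of the condition must come from a broken circuit.
  obtain ⟨i, hi⟩ : ∃ i, v i ∈ Submodule.span F (v '' {s | s ∈ l ∧ r i < r s}) := by
    by_contra! hcon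
    refine hnbc ⟨fun i _ => ?_, ?_⟩
    · simpa [bot_sup_eq] using hcon i
    · simpa [bot_sup_eq] using hw
  set Z := l.toFinset.filter fun s => r i < r s with hZ
  have hZc : (Z : Set ι) = {s | s ∈ l ∧ r i < r s} := by ext; simp [hZ]
  have hiZ : i ∉ Z := by simp [hZ]
  have hdep : ¬ LinearIndepOn F v ((insert i Z : Finset ι) : Set ι) := by
    rw [Finset.coe_insert, linearIndepOn_insert (by exact_mod_cast hiZ), hZc]
    exact fun h => h.2 hi
  have hwY : w ∉ Submodule.span F (v '' ((insert i Z : Finset ι) : Set ι)) := by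
    intro h
    refine hw (Submodule.span_le.mpr ?_ h)
    rintro _ ⟨j, hj, rfl⟩
    rcases Finset.mem_insert.mp (Finset.mem_coe.mp hj) with rfl | hj
    · exact Submodule.span_mono (Set.image_mono fun s hs => hs.1) hi
    · exact Submodule.subset_span ⟨j, by simpa using (Finset.mem_filter.mp hj).1, rfl⟩
  obtain ⟨C, hC0, hCn, hCY, hCJ⟩ := hJ.circuit _ hdep hwY
  have hCl : ∀ c ∈ C, c ≠ i → c ∈ l ∧ r i < r c := fun c hc hci => by
    simpa [hZ, hci] using hCY c hc
  by_cases hsub : C ⊆ l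
  · exact Submodule.mem_sup_left (mono_mem_of_subset hJ.mul_ι_mem hCn hsub
      (mono_mem_of_contract_mem hJ.ι_mul_mem hC0 hCJ))
  have hil : i ∉ l := fun hil => hsub fun c hc => by
    by_cases hci : c = i
    · exact hci ▸ hil
    · exact (hCl c hc hci).1
  have hiC : i ∈ C := by
    by_contra hiC
    exact hsub fun c hc => (hCl c hc fun e => hiC (e ▸ hc)).1
  have hp := List.perm_cons_erase hiC
  set D := C.erase i with hD
  have hDn : D.Nodup := hCn.erase i
  have hDl : ∀ d ∈ D, d ∈ l ∧ r i < r d := fun d hd =>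
    have := (hCn.mem_erase_iff).mp hd
    hCl d this.2 this.1
  -- The boundary of e_i e_D rewrites e_D as e_i ∂e_D: each term trades some d in D for i, which is
  -- smaller in the order, so the sum of the `r`-values drops while the degree is kept.
  have hrel : mono K D - ExteriorAlgebra.ι K (Finsupp.single i 1) *
      contract (coordSum K ι) (mono K D) ∈ J := by
    have : contract (coordSum K ι) (mono K (i :: D)) ∈ J := by
      rcases mono_perm (K := K) hp with e | e <;> rw [e] at hCJ
      · exact hCJ
      · rwa [map_neg, neg_mem_iff] at hCJ
    rwa [mono_cons, contract_ι_mul, coordSum_single, one_smul] at this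
  obtain ⟨l₁, hp₁, hs₁⟩ := List.subperm_of_subset hDn fun d hd => (hDl d hd).1
  obtain ⟨R, hR⟩ := hs₁.exists_perm_append
  replace hR := hR.trans (hp₁.append_right R)
  refine mono_mem_of_perm hR ?_
  rw [mono_append, ← sub_add_cancel (mono K D) (ExteriorAlgebra.ι K (Finsupp.single i 1) *
      contract (coordSum K ι) (mono K D)), add_mul]
  refine add_mem (Submodule.mem_sup_left (mul_mono_mem hJ.mul_ι_mem R hrel)) ?_
  have hb := contract_mono_mem (coordSum K ι) D
  generalize contract (coordSum K ι) (mono K D) = y at hb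
  induction hb using Submodule.span_induction with
  | zero => simp
  | add y z _ _ hy hz => simpa [mul_add, add_mul] using add_mem hy hz
  | smul c y _ hy => simpa using Submodule.smul_mem _ c hy
  | mem y hy =>
    obtain ⟨d, D', hDD', rfl⟩ := hy
    have hd := hDl d (hDD'.mem_iff.mpr List.mem_cons_self)
    have hperm : l.Perm (d :: (D' ++ R)) := hR.trans (hDD'.append_right R)
    have hsum : (l.map r).sum = ((d :: (D' ++ R)).map r).sum := (hperm.map r).sum_eq
    have hlen := hperm.length_eq
    have := ih (((i :: (D' ++ R)).map r).sum) (by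
      rw [← hm, hsum, List.map_cons, List.map_cons, List.sum_cons, List.sum_cons]
      exact Nat.add_lt_add_right hd.2 _) (i :: (D' ++ R)) rfl
    rw [List.length_cons] at this hlen
    rw [← mono_cons, ← mono_append, hlen]
    exact this

end Straightening

/-! ### Exactness forces the signed count to vanish. -/

section Count

/-- Rank-nullity on A gives dim A = dim X(A) + dim(ker X ∩ A). As kernel equals image and X
exchanges the summands, ker X ∩ A is X(B), so the formula is symmetric in A and B. -/
lemma finrank_eq_of_exact {K M : Type*} [Field K] [AddCommGroup M] [Module K M]
    [FiniteDimensional K M] (X : M →ₗ[K] M) {A B : Submodule K M} (hc : IsCompl A B)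
    (hAB : ∀ a ∈ A, X a ∈ B) (hBA : ∀ b ∈ B, X b ∈ A) (hX : ∀ m, X m = 0 ↔ ∃ a, X a = m) :
    finrank K A = finrank K B := by
  have key : ∀ {A B : Submodule K M}, IsCompl A B → (∀ a ∈ A, X a ∈ B) → (∀ b ∈ B, X b ∈ A) →
      finrank K A = finrank K (A.map X) + finrank K (B.map X) := by
    intro A B hc hAB hBA
    rw [← LinearMap.finrank_range_add_finrank_ker (X.domRestrict A), LinearMap.range_domRestrict]
    congr 1
    rw [← Submodule.finrank_map_subtype_eq A (LinearMap.ker (X.domRestrict A))]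
    suffices h : (LinearMap.ker (X.domRestrict A)).map A.subtype = B.map X by rw [h]
    ext m
    constructor
    · rintro ⟨⟨a, ha⟩, h0, rfl⟩
      obtain ⟨c, hc'⟩ := (hX a).mp h0
      have hct : c ∈ A ⊔ B := hc.sup_eq_top ▸ Submodule.mem_top
      obtain ⟨p, hp, q, hq, rfl⟩ := Submodule.mem_sup.mp hct
      have h1 : X p = a - X q := by rw [← hc', map_add, add_sub_cancel_right]
      have h2 : X p ∈ A ⊓ B := ⟨h1 ▸ sub_mem ha (hBA q hq), hAB p hp⟩
      rw [hc.inf_eq_bot, Submodule.mem_bot] at h2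
      exact ⟨q, hq, by rw [map_add, h2, zero_add] at hc'; exact hc'⟩
    · rintro ⟨b, hb, rfl⟩
      exact ⟨⟨X b, hBA b hb⟩, (hX _).mpr ⟨b, rfl⟩, rfl⟩
  rw [key hc hAB hBA, key hc.symm hBA hAB, add_comm]

/-- If an endomorphism raising the degree of basis vectors by one is exact, then the signed count
of the basis vectors vanishes. -/
lemma sum_neg_one_pow_eq_zero_of_exact {K M σ : Type*} [Field K] [AddCommGroup M] [Module K M]
    [Fintype σ] {b : σ → M} (hb : LinearIndependent K b)
    (htop : Submodule.span K (Set.range b) = ⊤) (deg : σ → ℕ) (X : M →ₗ[K] M)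
    (hdeg : ∀ s, X (b s) ∈ Submodule.span K (b '' {t | deg t = deg s + 1}))
    (hX : ∀ m, X m = 0 ↔ ∃ a, X a = m) : ∑ s, (-1 : ℤ) ^ deg s = 0 := by
  classical
  have hfin : FiniteDimensional K M := by
    refine ⟨?_⟩
    rw [← htop]
    exact Submodule.fg_span (Set.finite_range b)
  -- Only the parity of the degree is needed. Comparing dimensions gives an identity in ℤ whatever
  -- the characteristic of K.
  set P : (ℕ → Prop) → Submodule K M := fun p => Submodule.span K (b '' {s | p (deg s)}) with hP
  have hcompl : IsCompl (P Even) (P fun n => ¬ Even n) := by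
    constructor
    · exact hb.disjoint_span_image (Set.disjoint_left.mpr fun S h1 h2 => h2 h1)
    · rw [codisjoint_iff, hP, ← Submodule.span_union, ← Set.image_union, ← htop,
        ← Set.image_univ]
      congr 2
      ext s
      simp [Nat.even_or_odd]
  have hstep : ∀ p q : ℕ → Prop, (∀ n, p n → q (n + 1)) → ∀ a ∈ P p, X a ∈ P q := by
    intro p q hpq a ha
    induction ha using Submodule.span_induction with
    | zero => simp
    | add y z _ _ hy hz => rw [map_add]; exact add_mem hy hz
    | smul c y _ hy => rw [map_smul]; exact Submodule.smul_mem _ c hy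
    | mem y hy =>
      obtain ⟨s, hs, rfl⟩ := hy
      refine Submodule.span_mono (Set.image_mono fun t ht => ?_) (hdeg s)
      rw [Set.mem_ofPred_eq] at ht ⊢
      exact ht ▸ hpq _ hs
  have hrank := finrank_eq_of_exact X hcompl
    (hstep Even (fun n => ¬ Even n) fun n hn => by simpa [Nat.even_add_one] using hn)
    (hstep (fun n => ¬ Even n) Even fun n hn => by simpa [Nat.even_add_one] using hn) hX
  have hcard : ∀ (p : ℕ → Prop) [DecidablePred p], finrank K (P p) =
      (Finset.univ.filter fun s => p (deg s)).card := by
    intro p _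
    have h1 := finrank_span_eq_card (hb.comp (fun s : {s // p (deg s)} => s.1)
      Subtype.val_injective)
    rw [Set.range_comp, Subtype.range_coe_subtype] at h1
    rw [hP, h1, Fintype.card_subtype]
  rw [hcard Even, hcard fun n => ¬ Even n] at hrank
  have hpow : ∀ n : ℕ, (-1 : ℤ) ^ n = if Even n then 1 else -1 := fun n => by
    split_ifs with h
    · exact h.neg_one_pow
    · exact (Nat.not_even_iff_odd.mp h).neg_one_pow
  simp only [hpow]
  rw [Finset.sum_ite, Finset.sum_const, Finset.sum_const, hrank]
  simp

variable {K : Type*} [Field K] {F U ι : Type*} [Field F] [AddCommGroup U] [Module F U]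
  {v : ι → U} {w : U} {r : ι → ℕ} [Fintype ι] {J : Submodule K (ExteriorAlgebra K (ι →₀ K))}

lemma IsOrlikSolomon.dualForm_eq_zero (hJ : IsOrlikSolomon v w F J) {S : Finset ι}
    (h : IsNbc v w r (⊥ : Submodule F U) Finset.univ S) :
    ∀ y ∈ J, dualForm K F v r S y = 0 := by
  intro y hy
  rw [dualForm, LinearMap.comp_apply, AlgHom.toLinearMap_apply,
    hJ.map_eq_zero (levelHom K F v r S) (fun l hl => h.levelHom_contract_eq_zero hl)
      (fun l hl => h.levelHom_mono_eq_zero hl) y hy, map_zero]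

/-- The monomials without broken circuits are linearly independent modulo the relations. -/
lemma IsOrlikSolomon.linearIndependent (hr : Function.Injective r)
    (hJ : IsOrlikSolomon v w F J) :
    LinearIndependent K
      (fun S : {S : Finset ι // IsNbc v w r (⊥ : Submodule F U) Finset.univ S} =>
        J.mkQ (mono K S.1.toList)) := by
  classical
  rw [linearIndependent_iff']
  intro s g hg S hS
  have h1 := congr_arg (J.liftQ (dualForm K F v r S.1) (hJ.dualForm_eq_zero S.2)) hg
  have h2 : ∀ y, J.liftQ (dualForm K F v r S.1) (hJ.dualForm_eq_zero S.2) (J.mkQ y) =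
    dualForm K F v r S.1 y := fun y => rfl
  rw [map_sum, map_zero, Finset.sum_eq_single S] at h1
  · rwa [map_smul, h2, S.2.dualForm_self hr, smul_eq_mul, mul_one] at h1
  · intro T _ hT
    rw [map_smul, h2, S.2.dualForm_of_ne hr T.2 fun e => hT (Subtype.ext e), smul_zero]
  · exact fun h => absurd hS h

lemma IsOrlikSolomon.mkQ_mono_mem (hJ : IsOrlikSolomon v w F J) (l : List ι) :
    J.mkQ (mono K l) ∈ Submodule.span K
      ((fun S : {S : Finset ι // IsNbc v w r (⊥ : Submodule F U) Finset.univ S} =>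
        J.mkQ (mono K S.1.toList)) '' {S | S.1.card = l.length}) := by
  have h := Submodule.mem_map_of_mem (f := J.mkQ) (hJ.mono_mem (r := r) l)
  rw [Submodule.map_sup, Submodule.map_span] at h
  refine (sup_le ?_ (Submodule.span_mono ?_) : _ ≤ Submodule.span K _) h
  · rintro _ ⟨y, hy, rfl⟩
    have : J.mkQ y = 0 := by simpa using hy
    rw [this]; exact zero_mem _
  · rintro _ ⟨_, ⟨S, hS, hc, rfl⟩, rfl⟩
    exact ⟨⟨S, hS⟩, hc, rfl⟩

lemma IsOrlikSolomon.mkQ_ι_mul_mono_mem (hJ : IsOrlikSolomon v w F J) (x : ι →₀ K)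
    (S : {S : Finset ι // IsNbc v w r (⊥ : Submodule F U) Finset.univ S}) :
    J.mkQ (ExteriorAlgebra.ι K x * mono K S.1.toList) ∈ Submodule.span K
      ((fun S : {S : Finset ι // IsNbc v w r (⊥ : Submodule F U) Finset.univ S} =>
        J.mkQ (mono K S.1.toList)) '' {T | T.1.card = S.1.card + 1}) := by
  induction x using Finsupp.induction_linear with
  | zero => simp
  | add x y hx hy => rw [map_add, add_mul, map_add]; exact add_mem hx hy
  | single i c =>
    have h : (Finsupp.single i c : ι →₀ K) = c • Finsupp.single i 1 := by simp
    rw [h, map_smul, smul_mul_assoc, ← mono_cons, map_smul]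
    have := hJ.mkQ_mono_mem (r := r) (i :: S.1.toList)
    rw [List.length_cons, Finset.length_toList] at this
    exact Submodule.smul_mem _ _ this

lemma IsOrlikSolomon.span_eq_top (hJ : IsOrlikSolomon v w F J) :
    Submodule.span K (Set.range
      (fun S : {S : Finset ι // IsNbc v w r (⊥ : Submodule F U) Finset.univ S} =>
        J.mkQ (mono K S.1.toList))) = ⊤ := by
  rw [eq_top_iff, ← J.range_mkQ, ← Submodule.map_top, ← span_range_mono, Submodule.map_span,
    Submodule.span_le]
  rintro _ ⟨_, ⟨l, rfl⟩, rfl⟩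
  exact Submodule.span_mono (Set.image_subset_range _ _) (hJ.mkQ_mono_mem l)

/-- If multiplication by `x` is exact modulo the relations, then the signed count of the sets
without broken circuits vanishes. -/
theorem IsOrlikSolomon.nbcSum_eq_zero (hr : Function.Injective r)
    (hJ : IsOrlikSolomon v w F J) (x : ι →₀ K)
    (hx : ∀ q, ExteriorAlgebra.ι K x * q ∈ J → ∃ a, q - ExteriorAlgebra.ι K x * a ∈ J) :
    nbcSum v w r (⊥ : Submodule F U) Finset.univ = 0 := by
  classical
  let X : (ExteriorAlgebra K (ι →₀ K) ⧸ J) →ₗ[K] (ExteriorAlgebra K (ι →₀ K) ⧸ J) :=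
    J.mapQ J (LinearMap.mulLeft K (ExteriorAlgebra.ι K x)) fun y hy => hJ.ι_mul_mem x y hy
  have hXmk : ∀ y, X (J.mkQ y) = J.mkQ (ExteriorAlgebra.ι K x * y) := fun y => rfl
  have hmk0 : ∀ y, J.mkQ y = 0 ↔ y ∈ J := fun y => by
    rw [← LinearMap.mem_ker, Submodule.ker_mkQ]
  have hsum := sum_neg_one_pow_eq_zero_of_exact (hJ.linearIndependent hr) hJ.span_eq_top
    (fun S => S.1.card) X ?_ ?_
  · rw [nbcSum, Finset.powerset_univ, ← Finset.sum_filter, ← hsum]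
    exact Finset.sum_subtype _ (by simp) _
  · intro S
    rw [hXmk]
    exact hJ.mkQ_ι_mul_mono_mem x S
  · intro m
    obtain ⟨q, rfl⟩ := J.mkQ_surjective m
    constructor
    · intro h
      rw [hXmk, hmk0] at h
      obtain ⟨a, ha⟩ := hx q h
      refine ⟨J.mkQ a, ?_⟩
      rw [hXmk, eq_comm, ← sub_eq_zero, ← map_sub, hmk0]
      exact ha
    · rintro ⟨a, ha⟩
      obtain ⟨a, rfl⟩ := J.mkQ_surjective a
      rw [← ha, hXmk, hXmk, ← mul_assoc, ExteriorAlgebra.ι_sq_zero, zero_mul, map_zero]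

end Count

end OrlikSolomon

namespace HyperplaneArrangement

/-! ### Geometry of hyperplanes in terms of vectors of W* × ℂ. -/

section Vectors

variable {W : Type*} [AddCommGroup W] [Module ℂ W] (𝒜 : HyperplaneArrangement W)

/-- A linear form defining a hyperplane of the arrangement up to a constant. -/
noncomputable def form (H : 𝒜.hyperplanes) : Dual ℂ W := (𝒜.isHyperplane H H.2).choose

/-- The vector of `W* × ℂ` defining a hyperplane of the arrangement. -/
noncomputable def vec (H : 𝒜.hyperplanes) : Dual ℂ W × ℂ :=
  (𝒜.form H, (𝒜.isHyperplane H H.2).choose_spec.choose)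

variable {𝒜}

lemma form_ne_zero (H : 𝒜.hyperplanes) : 𝒜.form H ≠ 0 :=
  (𝒜.isHyperplane H H.2).choose_spec.choose_spec.1

lemma mem_iff (H : 𝒜.hyperplanes) (x : W) :
    x ∈ (H : AffineSubspace ℂ W) ↔ 𝒜.form H x = (𝒜.vec H).2 := by
  rw [← SetLike.mem_coe, (𝒜.isHyperplane H H.2).choose_spec.choose_spec.2]
  rfl

lemma vec_ne_zero (H : 𝒜.hyperplanes) : 𝒜.vec H ≠ 0 := fun h =>
  form_ne_zero H (congr_arg Prod.fst h)

lemma vec_notMem_span_singleton {H H' : 𝒜.hyperplanes} (h : H ≠ H') :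
    𝒜.vec H ∉ Submodule.span ℂ {𝒜.vec H'} := by
  intro hm
  obtain ⟨c, hc⟩ := Submodule.mem_span_singleton.mp hm
  have hc0 : c ≠ 0 := by
    rintro rfl
    exact vec_ne_zero H (by rw [← hc, zero_smul])
  refine h (Subtype.ext (SetLike.ext fun x => ?_))
  rw [mem_iff, mem_iff]
  have h1 : 𝒜.form H = c • 𝒜.form H' := (congr_arg Prod.fst hc).symm
  have h2 : (𝒜.vec H).2 = c * (𝒜.vec H').2 := (congr_arg Prod.snd hc).symm
  rw [h1, h2, LinearMap.smul_apply, smul_eq_mul, mul_right_inj' hc0]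

lemma map_fst_span_vec (T : Set 𝒜.hyperplanes) :
    (Submodule.span ℂ (𝒜.vec '' T)).map (LinearMap.fst ℂ (Dual ℂ W) ℂ) =
      Submodule.span ℂ (𝒜.form '' T) := by
  rw [Submodule.map_span, Set.image_image]
  rfl

lemma eq_of_mem_span_of_mem_span {M : Submodule ℂ (Dual ℂ W × ℂ)}
    (hM : ((0, 1) : Dual ℂ W × ℂ) ∉ M) {f : Dual ℂ W} {c c' : ℂ} (h : (f, c) ∈ M)
    (h' : (f, c') ∈ M) : c = c' := by
  by_contra hne
  refine hM ((Submodule.smul_mem_iff _ (sub_ne_zero.mpr hne)).mp ?_)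
  simpa using sub_mem h h'

variable [FiniteDimensional ℂ W]

/-- A set of hyperplanes has a common point iff the vector at infinity is not in the span of the
corresponding vectors. -/
lemma exists_common_point_iff (T : Set 𝒜.hyperplanes) :
    (∃ p : W, ∀ H ∈ T, p ∈ (H : AffineSubspace ℂ W)) ↔
      ((0, 1) : Dual ℂ W × ℂ) ∉ Submodule.span ℂ (𝒜.vec '' T) := by
  constructor
  · rintro ⟨p, hp⟩ hmem
    let f : Dual ℂ W × ℂ →ₗ[ℂ] ℂ :=
      (LinearMap.applyₗ p).comp (LinearMap.fst ℂ (Dual ℂ W) ℂ) - LinearMap.snd ℂ (Dual ℂ W) ℂ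
    have hle : Submodule.span ℂ (𝒜.vec '' T) ≤ LinearMap.ker f := by
      rw [Submodule.span_le]
      rintro _ ⟨H, hH, rfl⟩
      exact sub_eq_zero.mpr ((mem_iff H p).mp (hp H hH))
    have := hle hmem
    simp [f] at this
  · intro hmem
    obtain ⟨f, hf, hle⟩ := Submodule.exists_le_ker_of_notMem hmem
    obtain ⟨p, hp⟩ := (evalEquiv ℂ W).surjective (f.comp (LinearMap.inl ℂ (Dual ℂ W) ℂ))
    set t := f (0, 1) with ht
    -- The functional is (α, c) ↦ α(p) + tc with t ≠ 0; its vanishing on (α, c) says that -p/t lies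
    -- on α = c.
    refine ⟨-(t⁻¹ • p), fun H hH => (mem_iff H _).mpr ?_⟩
    have h1 : f (𝒜.vec H) = 0 := hle (Submodule.subset_span ⟨H, hH, rfl⟩)
    have h2 : f (𝒜.form H, 0) = 𝒜.form H p := by
      have := LinearMap.congr_fun hp (𝒜.form H)
      simpa using this.symm
    have h3 : 𝒜.vec H = (𝒜.form H, 0) + (𝒜.vec H).2 • ((0, 1) : Dual ℂ W × ℂ) := by
      simp [vec]
    rw [h3, map_add, map_smul, h2, ← ht, smul_eq_mul] at h1
    rw [map_neg, map_smul, smul_eq_mul, eq_neg_of_add_eq_zero_left h1]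
    field_simp

/-- The codimension of a nonempty intersection of hyperplanes is the rank of the corresponding
vectors. -/
lemma finrank_direction_add_finrank_span {T : Set 𝒜.hyperplanes}
    (h : ((0, 1) : Dual ℂ W × ℂ) ∉ Submodule.span ℂ (𝒜.vec '' T)) :
    finrank ℂ (sInf (Subtype.val '' T) : AffineSubspace ℂ W).direction +
      finrank ℂ (Submodule.span ℂ (𝒜.vec '' T)) = finrank ℂ W := by
  obtain ⟨p, hp⟩ := (exists_common_point_iff T).mpr h
  have hmem : ∀ x : W, x ∈ (sInf (Subtype.val '' T) : AffineSubspace ℂ W) ↔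
      ∀ H ∈ T, 𝒜.form H x = (𝒜.vec H).2 := by
    intro x
    rw [AffineSubspace.mem_sInf_iff]
    exact ⟨fun hx H hH => (mem_iff H x).mp (hx _ ⟨H, hH, rfl⟩), by
      rintro hx _ ⟨H, hH, rfl⟩; exact (mem_iff H x).mpr (hx H hH)⟩
  have hp' : p ∈ (sInf (Subtype.val '' T) : AffineSubspace ℂ W) :=
    (hmem p).mpr fun H hH => (mem_iff H p).mp (hp H hH)
  have hdir : (sInf (Subtype.val '' T) : AffineSubspace ℂ W).direction =
      (Submodule.span ℂ (𝒜.form '' T)).dualCoannihilator := by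
    ext u
    rw [← AffineSubspace.vadd_mem_iff_mem_direction u hp', hmem, Submodule.mem_dualCoannihilator]
    constructor
    · intro hu f hf
      induction hf using Submodule.span_induction with
      | zero => rfl
      | add f g _ _ hf hg => simp [hf, hg]
      | smul c f _ hf => simp [hf]
      | mem f hf =>
        obtain ⟨H, hH, rfl⟩ := hf
        have h1 := hu H hH
        rwa [vadd_eq_add, map_add, (mem_iff H p).mp (hp H hH), add_eq_right] at h1
    · intro hu H hH
      rw [vadd_eq_add, map_add, (mem_iff H p).mp (hp H hH),
        hu _ (Submodule.subset_span ⟨H, hH, rfl⟩), zero_add]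
  have hrk : finrank ℂ (Submodule.span ℂ (𝒜.form '' T)) =
      finrank ℂ (Submodule.span ℂ (𝒜.vec '' T)) := by
    rw [← map_fst_span_vec, ← LinearMap.range_domRestrict]
    refine LinearMap.finrank_range_of_inj ?_
    rintro ⟨⟨f, c⟩, hx⟩ ⟨⟨g, d⟩, hy⟩ hxy
    obtain rfl : f = g := hxy
    obtain rfl := eq_of_mem_span_of_mem_span h hx hy
    rfl
  rw [hdir, ← hrk, add_comm]
  exact Subspace.finrank_add_finrank_dualCoannihilator_eq _

lemma linearIndepOn_finset_iff_card_le {F U ι : Type*} [Field F] [AddCommGroup U] [Module F U]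
    (v : ι → U) (T : Finset ι) :
    LinearIndepOn F v (T : Set ι) ↔ T.card ≤ finrank F (Submodule.span F (v '' (T : Set ι))) := by
  have h : v '' (T : Set ι) = Set.range fun i : (T : Set ι) => v i := Set.image_eq_range _ _
  rw [LinearIndepOn, linearIndependent_iff_card_le_finrank_span, h]
  simp [Set.finrank]

lemma hyperplanesDependent_iff (T : Finset 𝒜.hyperplanes) :
    HyperplanesDependent (Subtype.val '' (T : Set 𝒜.hyperplanes)) ↔
      ((0, 1) : Dual ℂ W × ℂ) ∉ Submodule.span ℂ (𝒜.vec '' (T : Set 𝒜.hyperplanes)) ∧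
        ¬ LinearIndepOn ℂ 𝒜.vec (T : Set 𝒜.hyperplanes) := by
  have hne : ((sInf (Subtype.val '' (T : Set 𝒜.hyperplanes)) : AffineSubspace ℂ W) :
      Set W).Nonempty ↔
        ((0, 1) : Dual ℂ W × ℂ) ∉ Submodule.span ℂ (𝒜.vec '' (T : Set 𝒜.hyperplanes)) := by
    rw [← exists_common_point_iff]
    refine exists_congr fun p => ?_
    rw [SetLike.mem_coe, AffineSubspace.mem_sInf_iff]
    exact Set.forall_mem_image
  rw [HyperplanesDependent, hne]
  refine and_congr_right fun h => ?_
  rw [linearIndepOn_finset_iff_card_le, not_le, Set.ncard_image_of_injective _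
    Subtype.val_injective, Set.ncard_coe_finset, ← finrank_direction_add_finrank_span h]
  omega

/-- Removing H leaves a set that still has a common point and, by minimality, independent vectors;
the dependence must then involve H. -/
lemma vec_mem_span_of_minimal {T : Finset 𝒜.hyperplanes}
    (h : Minimal HyperplanesDependent (Subtype.val '' (T : Set 𝒜.hyperplanes)))
    {H : 𝒜.hyperplanes} (hH : H ∈ T) :
    𝒜.vec H ∈ Submodule.span ℂ (𝒜.vec '' {H' | H' ∈ T ∧ H' ≠ H}) := by
  classical
  have hset : ((T.erase H : Finset 𝒜.hyperplanes) : Set 𝒜.hyperplanes) =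
      {H' | H' ∈ T ∧ H' ≠ H} := by
    ext; simp [and_comm]
  have h1 := (hyperplanesDependent_iff T).mp h.prop
  have hsub : ((T.erase H : Finset 𝒜.hyperplanes) : Set 𝒜.hyperplanes) ⊆ T := by
    exact_mod_cast T.erase_subset H
  have h2 : ¬ HyperplanesDependent
      (Subtype.val '' ((T.erase H : Finset 𝒜.hyperplanes) : Set 𝒜.hyperplanes)) := by
    intro hd
    obtain ⟨H', hH', he⟩ := h.le_of_le hd (Set.image_mono hsub) ⟨H, hH, rfl⟩
    rw [Subtype.val_injective he] at hH'
    simp at hH'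
  rw [hyperplanesDependent_iff, not_and_not_right] at h2
  have h3 := h2 fun hm => h1.1 (Submodule.span_mono (Set.image_mono hsub) hm)
  have h4 := h1.2
  rw [← Finset.insert_erase hH, Finset.coe_insert, linearIndepOn_insert (by simp)] at h4
  rw [← hset]
  by_contra h5
  exact h4 ⟨h3, h5⟩

lemma exists_minimal_dependent {T : Finset 𝒜.hyperplanes}
    (h : ((0, 1) : Dual ℂ W × ℂ) ∉ Submodule.span ℂ (𝒜.vec '' (T : Set 𝒜.hyperplanes)))
    (hT : ¬ LinearIndepOn ℂ 𝒜.vec (T : Set 𝒜.hyperplanes)) :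
    ∃ C ⊆ T, C.Nonempty ∧
      Minimal HyperplanesDependent (Subtype.val '' (C : Set 𝒜.hyperplanes)) := by
  classical
  obtain ⟨C, hCT, hC⟩ := exists_minimal_le_of_wellFoundedLT
    (fun C : Finset 𝒜.hyperplanes => HyperplanesDependent (Subtype.val '' (C : Set 𝒜.hyperplanes)))
    T ((hyperplanesDependent_iff T).mpr ⟨h, hT⟩)
  refine ⟨C, hCT, ?_, hC.prop, ?_⟩
  · rw [Finset.nonempty_iff_ne_empty]
    rintro rfl
    exact ((hyperplanesDependent_iff _).mp hC.prop).2 (by simp)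
  · intro S hS hSC
    obtain ⟨D, hDC, rfl⟩ := Set.subset_image_iff.mp hSC
    lift D to Finset 𝒜.hyperplanes using C.finite_toSet.subset hDC
    exact Set.image_mono (by exact_mod_cast hC.le_of_le hS (by exact_mod_cast hDC))

end Vectors

/-! ### From irreducibility to connectedness. -/

section Irreducible

/-- If the spans met only in zero, the common kernel V₁ of the forms in Tᶜ and the common kernel V₂
of those in T would add up to the whole space, and coordinates adapted to them would present the
arrangement as a product. -/
lemma IsIrreducible.not_disjoint {ℓ : ℕ} {𝒜 : HyperplaneArrangement (Fin ℓ → ℂ)}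
    (h : 𝒜.IsIrreducible) {T : Set 𝒜.hyperplanes} (hT : T.Nonempty) (hT' : Tᶜ.Nonempty) :
    ¬ Disjoint (Submodule.span ℂ (𝒜.form '' T)) (Submodule.span ℂ (𝒜.form '' Tᶜ)) := by
  intro hd
  set A₁ := Submodule.span ℂ (𝒜.form '' T) with hA₁
  set A₂ := Submodule.span ℂ (𝒜.form '' Tᶜ) with hA₂
  set V₁ := A₂.dualCoannihilator with hV₁
  set V₂ := A₁.dualCoannihilator with hV₂
  have hsup : V₁ ⊔ V₂ = ⊤ := by
    rw [← Subspace.dualAnnihilator_inj, Submodule.dualAnnihilator_sup_eq,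
      Subspace.dualCoannihilator_dualAnnihilator_eq, Subspace.dualCoannihilator_dualAnnihilator_eq,
      hd.symm.eq_bot, Submodule.dualAnnihilator_top]
  -- The sum V₁ + V₂ need not be direct here, so V₂ is cut down to a complement V₃ of V₁.
  obtain ⟨D, hD⟩ := Submodule.exists_isCompl (V₁ ⊓ V₂)
  have hc : IsCompl V₁ (D ⊓ V₂) := by
    constructor
    · rw [disjoint_iff, inf_left_comm, inf_comm]
      exact hD.inf_eq_bot
    · rw [codisjoint_iff, eq_top_iff, ← hsup]
      refine sup_le le_sup_left ?_
      have : V₂ ≤ (V₁ ⊓ V₂) ⊔ (D ⊓ V₂) := by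
        rw [← sup_inf_assoc_of_le D (inf_le_right : V₁ ⊓ V₂ ≤ V₂), hD.sup_eq_top, top_inf_eq]
      exact this.trans (sup_le_sup_right inf_le_left _)
  set V₃ := D ⊓ V₂
  let e₁ := (finBasis ℂ V₁).equivFun
  let e₂ := (finBasis ℂ V₃).equivFun
  let ψ : ((Fin (finrank ℂ V₁) → ℂ) × (Fin (finrank ℂ V₃) → ℂ)) ≃ₗ[ℂ] (Fin ℓ → ℂ) :=
    (e₁.symm.prodCongr e₂.symm).trans (Submodule.prodEquivOfIsCompl V₁ V₃ hc)
  have hψ : ∀ y, ψ y = (e₁.symm y.1 : Fin ℓ → ℂ) + e₂.symm y.2 := fun y => rfl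
  have hT₁ : ∀ H ∈ T, ∀ x ∈ V₃, 𝒜.form H x = 0 := fun H hH x hx =>
    (Submodule.mem_dualCoannihilator x).mp hx.2 _ (Submodule.subset_span ⟨H, hH, rfl⟩)
  have hT₂ : ∀ H ∈ Tᶜ, ∀ x ∈ V₁, 𝒜.form H x = 0 := fun H hH x hx =>
    (Submodule.mem_dualCoannihilator x).mp hx _ (Submodule.subset_span ⟨H, hH, rfl⟩)
  let i₁ : (Fin (finrank ℂ V₁) → ℂ) →ₗ[ℂ] (Fin ℓ → ℂ) := V₁.subtype ∘ₗ e₁.symm.toLinearMap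
  let i₂ : (Fin (finrank ℂ V₃) → ℂ) →ₗ[ℂ] (Fin ℓ → ℂ) := V₃.subtype ∘ₗ e₂.symm.toLinearMap
  have hne : ∀ H, (∃ x ∈ V₁, 𝒜.form H x ≠ 0) ∨ (∃ x ∈ V₃, 𝒜.form H x ≠ 0) := by
    intro H
    by_contra! hcon
    refine form_ne_zero H (LinearMap.ext fun x => ?_)
    have hx : x ∈ V₁ ⊔ V₃ := hc.sup_eq_top ▸ Submodule.mem_top
    obtain ⟨y, hy, z, hz, rfl⟩ := Submodule.mem_sup.mp hx
    rw [map_add, hcon.1 y hy, hcon.2 z hz, add_zero, LinearMap.zero_apply]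
  let 𝒜₁ : HyperplaneArrangement (Fin (finrank ℂ V₁) → ℂ) :=
    { hyperplanes := (fun H : 𝒜.hyperplanes => H.1.comap i₁.toAffineMap) '' T
      finite := by
        have := 𝒜.finite.to_subtype
        exact Set.toFinite _
      isHyperplane := by
        rintro _ ⟨H, hH, rfl⟩
        refine ⟨𝒜.form H ∘ₗ i₁, (𝒜.vec H).2, ?_, ?_⟩
        · intro h0
          rcases hne H with ⟨x, hx, hx0⟩ | ⟨x, hx, hx0⟩
          · have := LinearMap.congr_fun h0 (e₁ ⟨x, hx⟩)
            simp [i₁, hx0] at this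
          · exact hx0 (hT₁ H hH x hx)
        · ext x
          simp [mem_iff] }
  let 𝒜₂ : HyperplaneArrangement (Fin (finrank ℂ V₃) → ℂ) :=
    { hyperplanes := (fun H : 𝒜.hyperplanes => H.1.comap i₂.toAffineMap) '' Tᶜ
      finite := by
        have := 𝒜.finite.to_subtype
        exact Set.toFinite _
      isHyperplane := by
        rintro _ ⟨H, hH, rfl⟩
        refine ⟨𝒜.form H ∘ₗ i₂, (𝒜.vec H).2, ?_, ?_⟩
        · intro h0
          rcases hne H with ⟨x, hx, hx0⟩ | ⟨x, hx, hx0⟩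
          · exact hx0 (hT₂ H hH x hx)
          · have := LinearMap.congr_fun h0 (e₂ ⟨x, hx⟩)
            simp [i₂, hx0] at this
        · ext x
          simp [mem_iff] }
  let φ : (Fin ℓ → ℂ) ≃ᵃ[ℂ] (Fin (finrank ℂ V₁) → ℂ) × (Fin (finrank ℂ V₃) → ℂ) :=
    ψ.symm.toAffineEquiv
  have hx : ∀ x, x = (i₁ (φ x).1) + i₂ (φ x).2 := fun x => by
    have := hψ (ψ.symm x)
    rw [LinearEquiv.apply_symm_apply] at this
    exact this
  have hφ₁ : ∀ H ∈ T, ((H.1.comap i₁.toAffineMap).comap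
      (LinearMap.fst ℂ _ _).toAffineMap).comap (φ : (Fin ℓ → ℂ) →ᵃ[ℂ]
        (Fin (finrank ℂ V₁) → ℂ) × (Fin (finrank ℂ V₃) → ℂ)) = H.1 := by
    intro H hH
    ext x
    have h0 : 𝒜.form H (i₂ (φ x).2) = 0 := hT₁ H hH _ (e₂.symm (φ x).2).2
    rw [AffineSubspace.mem_comap, AffineSubspace.mem_comap, AffineSubspace.mem_comap, mem_iff,
      mem_iff]
    conv_rhs => rw [hx x, map_add, h0, add_zero]
    rfl
  have hφ₂ : ∀ H ∈ Tᶜ, ((H.1.comap i₂.toAffineMap).comap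
      (LinearMap.snd ℂ _ _).toAffineMap).comap (φ : (Fin ℓ → ℂ) →ᵃ[ℂ]
        (Fin (finrank ℂ V₁) → ℂ) × (Fin (finrank ℂ V₃) → ℂ)) = H.1 := by
    intro H hH
    ext x
    have h0 : 𝒜.form H (i₁ (φ x).1) = 0 := hT₂ H hH _ (e₁.symm (φ x).1).2
    rw [AffineSubspace.mem_comap, AffineSubspace.mem_comap, AffineSubspace.mem_comap, mem_iff,
      mem_iff]
    conv_rhs => rw [hx x, map_add, h0, zero_add]
    rfl
  have hprod : 𝒜.hyperplanes =
      (fun H => H.comap (φ : (Fin ℓ → ℂ) →ᵃ[ℂ]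
        (Fin (finrank ℂ V₁) → ℂ) × (Fin (finrank ℂ V₃) → ℂ))) '' (𝒜₁.prod 𝒜₂).hyperplanes := by
    ext H
    constructor
    · intro hH
      by_cases hHT : (⟨H, hH⟩ : 𝒜.hyperplanes) ∈ T
      · exact ⟨_, Or.inl ⟨_, ⟨_, hHT, rfl⟩, rfl⟩, hφ₁ _ hHT⟩
      · exact ⟨_, Or.inr ⟨_, ⟨_, hHT, rfl⟩, rfl⟩, hφ₂ _ hHT⟩
    · rintro ⟨_, ⟨_, ⟨H, hH, rfl⟩, rfl⟩ | ⟨_, ⟨H, hH, rfl⟩, rfl⟩, rfl⟩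
      · change AffineSubspace.comap _ _ ∈ _
        rw [hφ₁ H hH]; exact H.2
      · change AffineSubspace.comap _ _ ∈ _
        rw [hφ₂ H hH]; exact H.2
  rcases h.2 _ _ 𝒜₁ 𝒜₂ φ hprod with h0 | h0
  · exact (hT.image _).ne_empty h0
  · exact (hT'.image _).ne_empty h0

variable {ℓ : ℕ} {𝒜 : HyperplaneArrangement (Fin ℓ → ℂ)}

lemma isCentral_iff : 𝒜.IsCentral ↔
    ((0, 1) : Dual ℂ (Fin ℓ → ℂ) × ℂ) ∉ Submodule.span ℂ (𝒜.vec '' Set.univ) := by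
  rw [← exists_common_point_iff]
  simp [IsCentral]

lemma IsIrreducible.exists_mem_span (h : 𝒜.IsIrreducible) {T : Set 𝒜.hyperplanes}
    (hT : T.Nonempty) (hT' : Tᶜ.Nonempty) : ∃ f ≠ 0, ∃ c c',
      (f, c) ∈ Submodule.span ℂ (𝒜.vec '' T) ∧ (f, c') ∈ Submodule.span ℂ (𝒜.vec '' Tᶜ) := by
  have := h.not_disjoint hT hT'
  rw [Submodule.disjoint_def] at this
  push Not at this
  obtain ⟨f, hf, hf', hf0⟩ := this
  rw [← map_fst_span_vec] at hf hf'
  obtain ⟨⟨f, c⟩, hc, rfl⟩ := hf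
  obtain ⟨⟨g, c'⟩, hc', hg⟩ := hf'
  obtain rfl : g = f := hg
  exact ⟨_, hf0, c, c', hc, hc'⟩

variable [Fintype 𝒜.hyperplanes]

/-- A linear form common to the spans of Y and of its complement lifts to two vectors differing by a
multiple of w, and w always sits on the complementary side. -/
lemma IsIrreducible.isConn_of_not_isCentral (h : 𝒜.IsIrreducible) (hc : ¬ 𝒜.IsCentral) :
    OrlikSolomon.IsConn 𝒜.vec ((0, 1) : Dual ℂ (Fin ℓ → ℂ) × ℂ)
      (⊥ : Submodule ℂ _) Finset.univ := by
  rw [isCentral_iff, not_not] at hc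
  refine ⟨by simp, fun Y _ hY hle => ?_⟩
  rw [OrlikSolomon.closure, bot_sup_eq, bot_sup_eq, Finset.coe_univ,
    ← Set.compl_eq_univ_sdiff] at hle
  by_cases hY' : ((Y : Set 𝒜.hyperplanes)ᶜ).Nonempty
  · obtain ⟨f, hf0, c, c', h1, h2⟩ := h.exists_mem_span (T := (Y : Set 𝒜.hyperplanes)) hY hY'
    have h3 : (f, c) ∈ Submodule.span ℂ {((0, 1) : Dual ℂ (Fin ℓ → ℂ) × ℂ)} ⊔
        Submodule.span ℂ (𝒜.vec '' (Y : Set 𝒜.hyperplanes)ᶜ) := by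
      refine Submodule.mem_sup.mpr ⟨_, Submodule.smul_mem _ (c - c')
        (Submodule.mem_span_singleton_self _), _, h2, ?_⟩
      simp
    have := hle ⟨h3, h1⟩
    exact hf0 (congr_arg Prod.fst ((Submodule.mem_bot ℂ).mp this))
  -- When Y is everything, w itself lies on both sides because the arrangement is noncentral.
  · rw [Set.not_nonempty_iff_eq_empty, Set.compl_empty_iff] at hY'
    rw [hY'] at hle
    have := hle ⟨Submodule.mem_sup_left (Submodule.mem_span_singleton_self _), hc⟩
    simp at this

/-- The complement of Y contains H₀, and centrality makes the two lifts of a common linear form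
equal. -/
lemma IsIrreducible.isConn_of_isCentral [DecidableEq 𝒜.hyperplanes] (h : 𝒜.IsIrreducible)
    (hc : 𝒜.IsCentral) (H₀ : 𝒜.hyperplanes) :
    OrlikSolomon.IsConn 𝒜.vec (𝒜.vec H₀) (⊥ : Submodule ℂ _) (Finset.univ.erase H₀) := by
  rw [isCentral_iff] at hc
  refine ⟨by simpa using vec_ne_zero H₀, fun Y hYs hY hle => ?_⟩
  have hH₀ : H₀ ∉ Y := fun hm => (Finset.mem_erase.mp (hYs hm)).1 rfl
  rw [OrlikSolomon.closure, bot_sup_eq, bot_sup_eq] at hle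
  obtain ⟨f, hf0, c, c', h1, h2⟩ := h.exists_mem_span (T := (Y : Set 𝒜.hyperplanes)) hY
    ⟨H₀, by simpa using hH₀⟩
  obtain rfl := eq_of_mem_span_of_mem_span hc
    (Submodule.span_mono (Set.image_mono (Set.subset_univ _)) h1)
    (Submodule.span_mono (Set.image_mono (Set.subset_univ _)) h2)
  have h3 : Submodule.span ℂ (𝒜.vec '' (Y : Set 𝒜.hyperplanes)ᶜ) ≤
      Submodule.span ℂ {𝒜.vec H₀} ⊔
        Submodule.span ℂ (𝒜.vec '' (((Finset.univ.erase H₀ : Finset 𝒜.hyperplanes) :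
          Set 𝒜.hyperplanes) \ Y)) := by
    rw [Submodule.span_le]
    rintro _ ⟨H, hH, rfl⟩
    by_cases he : H = H₀
    · exact Submodule.mem_sup_left (he ▸ Submodule.mem_span_singleton_self _)
    · exact Submodule.mem_sup_right (Submodule.subset_span ⟨H, ⟨by simpa using he, hH⟩, rfl⟩)
  have := hle ⟨h3 h2, h1⟩
  exact hf0 (congr_arg Prod.fst ((Submodule.mem_bot ℂ).mp this))

end Irreducible

end HyperplaneArrangement

open OrlikSolomon

namespace HyperplaneArrangement

variable {K : Type*} [Field K]

/-! ### The Orlik–Solomon ideal satisfies the abstract relations. -/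

section Relations

variable {W : Type*} [AddCommGroup W] [Module ℂ W] {𝒜 : HyperplaneArrangement W}

lemma monomial_eq_mono {t : ℕ} (H : Fin t → 𝒜.hyperplanes) :
    𝒜.monomial K H = mono K (List.ofFn H) := by
  rw [monomial, ExteriorAlgebra.ιMulti_apply, mono, List.map_ofFn]
  rfl

lemma boundary_eq_contract {t : ℕ} (H : Fin (t + 1) → 𝒜.hyperplanes) :
    𝒜.boundary K H = contract (coordSum K 𝒜.hyperplanes) (mono K (List.ofFn H)) := by
  rw [← monomial_eq_mono, monomial, contract_ιMulti]
  simp [boundary, monomial, e]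

lemma val_image_mem_ofFn {t : ℕ} (H : Fin t → 𝒜.hyperplanes) :
    Subtype.val '' {H' | H' ∈ List.ofFn H} =
      Set.range fun j => (H j : AffineSubspace ℂ W) := by
  have h : {H' | H' ∈ List.ofFn H} = Set.range H := by
    ext H'
    exact List.mem_ofFn
  rw [h, ← Set.range_comp]
  rfl

lemma contract_mono_mem_orlikSolomonIdeal {l : List 𝒜.hyperplanes} (hne : l ≠ []) (hl : l.Nodup)
    (h : Minimal HyperplanesDependent (Subtype.val '' {H | H ∈ l})) :
    contract (coordSum K 𝒜.hyperplanes) (mono K l) ∈ 𝒜.orlikSolomonIdeal K := by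
  obtain ⟨t, H, rfl⟩ : ∃ (t : ℕ) (H : Fin (t + 1) → 𝒜.hyperplanes), l = List.ofFn H := by
    cases l with
    | nil => exact absurd rfl hne
    | cons a l => exact ⟨l.length, (a :: l).get, (List.ofFn_get _).symm⟩
  refine TwoSidedIdeal.subset_span (Or.inl ⟨t, H, List.nodup_ofFn.mp hl,
    val_image_mem_ofFn H ▸ h, (boundary_eq_contract H).symm⟩)

lemma mono_mem_orlikSolomonIdeal_of_inter_empty {l : List 𝒜.hyperplanes} (hl : l.Nodup)
    (h : ¬ ∃ p, ∀ H ∈ l, p ∈ (H : AffineSubspace ℂ W)) :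
    mono K l ∈ 𝒜.orlikSolomonIdeal K := by
  refine TwoSidedIdeal.subset_span (Or.inr ⟨l.length, l.get, List.nodup_iff_injective_get.mp hl, ?_,
    by rw [monomial_eq_mono, List.ofFn_get]⟩)
  rw [Set.eq_empty_iff_forall_notMem]
  intro p hp
  refine h ⟨p, fun H hH => ?_⟩
  obtain ⟨j, rfl⟩ := List.mem_iff_get.mp hH
  exact Set.mem_iInter.mp hp j

lemma map_eq_zero_of_mem_orlikSolomonIdeal [FiniteDimensional ℂ W] {R : Type*} [Ring R]
    [Algebra K R] (Φ : 𝒜.E K →ₐ[K] R)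
    (h₁ : ∀ l : List 𝒜.hyperplanes,
      (∀ H ∈ l, 𝒜.vec H ∈ Submodule.span ℂ (𝒜.vec '' {H' | H' ∈ l ∧ H' ≠ H})) →
      Φ (contract (coordSum K 𝒜.hyperplanes) (mono K l)) = 0)
    (h₂ : ∀ l : List 𝒜.hyperplanes,
      ((0, 1) : Dual ℂ W × ℂ) ∈ Submodule.span ℂ (𝒜.vec '' {H | H ∈ l}) → Φ (mono K l) = 0)
    {y : 𝒜.E K} (hy : y ∈ 𝒜.orlikSolomonIdeal K) : Φ y = 0 := by
  classical
  refine (TwoSidedIdeal.mem_ker Φ).mp ((TwoSidedIdeal.span_le.mpr ?_ :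
    TwoSidedIdeal.span (𝒜.orlikSolomonGenerators K) ≤ TwoSidedIdeal.ker Φ) hy)
  rintro _ (⟨t, H, hH, hmin, rfl⟩ | ⟨t, H, hH, hemp, rfl⟩)
  · rw [SetLike.mem_coe, TwoSidedIdeal.mem_ker, boundary_eq_contract]
    refine h₁ _ fun H' hH' => ?_
    rw [← val_image_mem_ofFn, ← List.coe_toFinset] at hmin
    simpa only [List.mem_toFinset] using
      vec_mem_span_of_minimal hmin (List.mem_toFinset.mpr hH')
  · rw [SetLike.mem_coe, TwoSidedIdeal.mem_ker, monomial_eq_mono]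
    refine h₂ _ ?_
    by_contra hcon
    obtain ⟨p, hp⟩ := (exists_common_point_iff _).mpr hcon
    refine (Set.eq_empty_iff_forall_notMem.mp hemp p) (Set.mem_iInter.mpr fun j => ?_)
    exact hp (H j) (by simp)

lemma exists_contract_mono_mem [FiniteDimensional ℂ W] {Y : Finset 𝒜.hyperplanes}
    (h : ((0, 1) : Dual ℂ W × ℂ) ∉ Submodule.span ℂ (𝒜.vec '' (Y : Set 𝒜.hyperplanes)))
    (hY : ¬ LinearIndepOn ℂ 𝒜.vec (Y : Set 𝒜.hyperplanes)) :
    ∃ l : List 𝒜.hyperplanes, l ≠ [] ∧ l.Nodup ∧ (∀ H ∈ l, H ∈ Y) ∧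
      contract (coordSum K 𝒜.hyperplanes) (mono K l) ∈ 𝒜.orlikSolomonIdeal K := by
  obtain ⟨C, hC, hne, hmin⟩ := exists_minimal_dependent h hY
  have h0 : C.toList ≠ [] := by simpa using hne.ne_empty
  refine ⟨C.toList, h0, C.nodup_toList, fun H hH => hC (Finset.mem_toList.mp hH), ?_⟩
  refine contract_mono_mem_orlikSolomonIdeal h0 C.nodup_toList ?_
  convert hmin using 2
  ext; simp

variable (K 𝒜) in
/-- The Orlik–Solomon ideal as a subspace. -/
noncomputable def relations : Submodule K (𝒜.E K) := (𝒜.orlikSolomonIdeal K).restrictScalars K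

lemma isOrlikSolomon_relations [FiniteDimensional ℂ W] :
    IsOrlikSolomon 𝒜.vec ((0, 1) : Dual ℂ W × ℂ) ℂ (relations K 𝒜) where
  ι_mul_mem _ _ hy := Ideal.mul_mem_left _ _ hy
  mul_ι_mem _ _ hy := Ideal.mul_mem_right _ _ hy
  circuit _ hY h := exists_contract_mono_mem h hY
  monomial l hl h := mono_mem_orlikSolomonIdeal_of_inter_empty hl fun hp =>
    (exists_common_point_iff {H | H ∈ l}).mp hp h
  map_eq_zero Φ h₁ h₂ _ hy := map_eq_zero_of_mem_orlikSolomonIdeal Φ h₁ h₂ hy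

variable (K) in
/-- The ideal generated by the Orlik–Solomon relations and the generator of a hyperplane. -/
noncomputable def relationsMod (H₀ : 𝒜.hyperplanes) : Submodule K (𝒜.E K) :=
  relations K 𝒜 ⊔ LinearMap.range (LinearMap.mulLeft K (ExteriorAlgebra.ι K (𝒜.e K H₀)))

lemma mem_relationsMod {H₀ : 𝒜.hyperplanes} {y : 𝒜.E K} : y ∈ relationsMod K H₀ ↔
    ∃ b, y - ExteriorAlgebra.ι K (𝒜.e K H₀) * b ∈ 𝒜.orlikSolomonIdeal K := by
  rw [relationsMod, Submodule.mem_sup]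
  constructor
  · rintro ⟨z, hz, _, ⟨b, rfl⟩, rfl⟩
    exact ⟨b, by rw [LinearMap.mulLeft_apply, add_sub_cancel_right]; exact hz⟩
  · rintro ⟨b, hb⟩
    exact ⟨_, hb, _, ⟨b, rfl⟩, by simp⟩

end Relations

/-! ### Central arrangements and the quotient by one generator. -/

section Central

variable {ℓ : ℕ} {𝒜 : HyperplaneArrangement (Fin ℓ → ℂ)}

lemma IsCentral.notMem_span (hc : 𝒜.IsCentral) (T : Set 𝒜.hyperplanes) :
    ((0, 1) : Dual ℂ (Fin ℓ → ℂ) × ℂ) ∉ Submodule.span ℂ (𝒜.vec '' T) := fun h =>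
  isCentral_iff.mp hc (Submodule.span_mono (Set.image_mono (Set.subset_univ _)) h)

/-- For a central arrangement all generators are boundaries, and ∂∂ = 0. The twisted Leibniz rule
involves the grade involution, so stability under it has to be proved in the same induction. -/
lemma IsCentral.contract_mem (hc : 𝒜.IsCentral) {y : 𝒜.E K}
    (hy : y ∈ 𝒜.orlikSolomonIdeal K) :
    contract (coordSum K 𝒜.hyperplanes) y ∈ 𝒜.orlikSolomonIdeal K := by
  suffices h : involution y ∈ TwoSidedIdeal.span (𝒜.orlikSolomonGenerators K) ∧
      contract (coordSum K 𝒜.hyperplanes) y ∈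
        TwoSidedIdeal.span (𝒜.orlikSolomonGenerators K) from h.2
  change y ∈ TwoSidedIdeal.span (𝒜.orlikSolomonGenerators K) at hy
  induction hy using TwoSidedIdeal.span_induction with
  | mem y hy =>
    have hy' := TwoSidedIdeal.subset_span hy
    rcases hy with ⟨t, H, hH, hmin, rfl⟩ | ⟨t, H, hH, hemp, rfl⟩
    · rw [boundary_eq_contract] at hy' ⊢
      rw [contract_contract, involution_contract, involution_mono]
      refine ⟨?_, zero_mem _⟩
      rcases neg_one_pow_eq_or (𝒜.E K) (List.ofFn H).length with h | h <;> rw [h]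
      · rw [one_mul]; exact neg_mem hy'
      · rw [neg_mul, one_mul, map_neg, neg_neg]; exact hy'
    · obtain ⟨p, hp⟩ := hc
      exact absurd hemp (Set.Nonempty.ne_empty ⟨p, Set.mem_iInter.mpr fun j => hp _ (H j).2⟩)
  | zero => simp [zero_mem]
  | add y z _ _ hy hz => rw [map_add, map_add]; exact ⟨add_mem hy.1 hz.1, add_mem hy.2 hz.2⟩
  | neg y _ hy => rw [map_neg, map_neg]; exact ⟨neg_mem hy.1, neg_mem hy.2⟩
  | left_absorb a y hy' hy =>
    rw [map_mul, contract_mul]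
    exact ⟨TwoSidedIdeal.mul_mem_left _ _ _ hy.1, add_mem (TwoSidedIdeal.mul_mem_left _ _ _ hy')
      (TwoSidedIdeal.mul_mem_left _ _ _ hy.2)⟩
  | right_absorb a y hy' hy =>
    rw [map_mul, contract_mul]
    exact ⟨TwoSidedIdeal.mul_mem_right _ _ _ hy.1, add_mem (TwoSidedIdeal.mul_mem_right _ _ _ hy.2)
      (TwoSidedIdeal.mul_mem_right _ _ _ hy.1)⟩

lemma IsCentral.isOrlikSolomon_relationsMod (hc : 𝒜.IsCentral) (H₀ : 𝒜.hyperplanes) :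
    IsOrlikSolomon 𝒜.vec (𝒜.vec H₀) ℂ (relationsMod K H₀) := by
  have hl : ∀ x, ∀ y ∈ relationsMod K H₀, ExteriorAlgebra.ι K x * y ∈ relationsMod K H₀ := by
    intro x y hy
    obtain ⟨b, hb⟩ := mem_relationsMod.mp hy
    refine mem_relationsMod.mpr ⟨-(ExteriorAlgebra.ι K x * b), ?_⟩
    have := Ideal.mul_mem_left _ (ExteriorAlgebra.ι K x) hb
    have h := eq_neg_of_add_eq_zero_left (ExteriorAlgebra.ι_add_mul_swap (R := K) x (𝒜.e K H₀))
    rwa [mul_sub, ← mul_assoc, h, neg_mul, mul_assoc, ← mul_neg] at this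
  have hr : ∀ x, ∀ y ∈ relationsMod K H₀, y * ExteriorAlgebra.ι K x ∈ relationsMod K H₀ := by
    intro x y hy
    obtain ⟨b, hb⟩ := mem_relationsMod.mp hy
    refine mem_relationsMod.mpr ⟨b * ExteriorAlgebra.ι K x, ?_⟩
    have := Ideal.mul_mem_right (ExteriorAlgebra.ι K x) _ hb
    rwa [sub_mul, mul_assoc] at this
  have hle : ∀ y ∈ 𝒜.orlikSolomonIdeal K, y ∈ relationsMod K H₀ := fun y hy =>
    Submodule.mem_sup_left hy
  have hmul : ∀ b, ExteriorAlgebra.ι K (𝒜.e K H₀) * b ∈ relationsMod K H₀ := fun b =>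
    Submodule.mem_sup_right ⟨b, rfl⟩
  refine ⟨hl, hr, fun Y hY _ => ?_, fun l hln h => ?_, fun Φ h₁ h₂ y hy => ?_⟩
  · obtain ⟨l, h0, h1, h2, h3⟩ := exists_contract_mono_mem (K := K) (hc.notMem_span _) hY
    exact ⟨l, h0, h1, h2, hle _ h3⟩
  · classical
    by_cases hH : H₀ ∈ l
    · refine mono_mem_of_perm (List.perm_cons_erase hH) ?_
      rw [mono_cons]
      exact hmul _
    -- A circuit C through H₀ has boundary e_{C∖H₀} - e_{H₀}∂e_{C∖H₀}, so modulo e_{H₀} the monomial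
    -- of C∖H₀ becomes a relation, as if H₀ were at infinity.
    have hdep : ¬ LinearIndepOn ℂ 𝒜.vec
        ((insert H₀ l.toFinset : Finset 𝒜.hyperplanes) : Set 𝒜.hyperplanes) := by
      rw [Finset.coe_insert, linearIndepOn_insert (by simpa using hH)]
      intro hi
      exact hi.2 (by simpa using h)
    obtain ⟨C, h0, hCn, hC, hm⟩ := exists_contract_mono_mem (K := K) (hc.notMem_span _) hdep
    have hCl : ∀ H ∈ C, H ≠ H₀ → H ∈ l := fun H hH hne => by simpa [hne] using hC H hH
    by_cases hHC : H₀ ∈ C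
    · have hp := List.perm_cons_erase hHC
      refine mono_mem_of_subset hr (hCn.erase H₀) (fun H hH => ?_) (?_ : mono K (C.erase H₀) ∈ _)
      · have := hCn.mem_erase_iff.mp hH
        exact hCl H this.2 this.1
      have h4 : contract (coordSum K 𝒜.hyperplanes) (mono K (H₀ :: C.erase H₀)) ∈
          relationsMod K H₀ := by
        rcases mono_perm (K := K) hp with e | e <;> rw [e] at hm
        · exact hle _ hm
        · rw [map_neg, neg_mem_iff] at hm
          exact hle _ hm
      rw [mono_cons, contract_ι_mul, coordSum_single, one_smul] at h4
      exact (Submodule.sub_mem_iff_left _ (hmul _)).mp h4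
    · exact mono_mem_of_subset hr hCn (fun H hH => hCl H hH fun e => hHC (e ▸ hH))
        (mono_mem_of_contract_mem hl h0 (hle _ hm))
  · obtain ⟨b, hb⟩ := mem_relationsMod.mp hy
    have h3 := map_eq_zero_of_mem_orlikSolomonIdeal Φ h₁
      (fun l h => absurd h (hc.notMem_span _)) hb
    have h4 : Φ (ExteriorAlgebra.ι K (𝒜.e K H₀)) = 0 := by
      have := h₂ [H₀] (Submodule.subset_span ⟨H₀, by simp, rfl⟩)
      rwa [mono_cons, mono_nil, mul_one] at this
    rw [map_sub, map_mul, h4, zero_mul, sub_zero] at h3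
    exact h3

/-- If multiplication by `x` is exact on the Orlik–Solomon algebra of a central arrangement and the
coordinates of `x` have sum zero, then it is exact modulo the generator of a hyperplane. -/
lemma IsCentral.exact_relationsMod (hc : 𝒜.IsCentral) (H₀ : 𝒜.hyperplanes) {x : 𝒜.V K}
    (hx0 : coordSum K 𝒜.hyperplanes x = 0)
    (hx : ∀ q, ExteriorAlgebra.ι K x * q ∈ 𝒜.orlikSolomonIdeal K →
      ∃ a, q - ExteriorAlgebra.ι K x * a ∈ 𝒜.orlikSolomonIdeal K) (q : 𝒜.E K)
    (hq : ExteriorAlgebra.ι K x * q ∈ relationsMod K H₀) :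
    ∃ a, q - ExteriorAlgebra.ι K x * a ∈ relationsMod K H₀ := by
  obtain ⟨b, hb⟩ := mem_relationsMod.mp hq
  set s := coordSum K 𝒜.hyperplanes
  set ε := ExteriorAlgebra.ι K (𝒜.e K H₀) with hε
  have h1 := hc.contract_mem hb
  have hs : s (𝒜.e K H₀) = 1 := coordSum_single _ _
  rw [map_sub, contract_ι_mul, contract_ι_mul, hx0, hs, zero_smul, one_smul, zero_sub] at h1
  have hswap : ExteriorAlgebra.ι K x * ε = -(ε * ExteriorAlgebra.ι K x) :=
    eq_neg_of_add_eq_zero_left (ExteriorAlgebra.ι_add_mul_swap (R := K) x (𝒜.e K H₀))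
  -- Applying ∂ to xq ≡ εb gives b ≡ ε∂b - x∂q. Multiplying by ε yields εb ≡ xε∂q, so x kills q -
  -- ε∂q modulo the ideal.
  have h2 : ExteriorAlgebra.ι K x * (q - ε * contract s q) ∈ 𝒜.orlikSolomonIdeal K := by
    have h3 := sub_mem hb (Ideal.mul_mem_left _ ε h1)
    have h4 : ε * ε = 0 := ExteriorAlgebra.ι_sq_zero _
    convert h3 using 1
    rw [mul_sub, ← mul_assoc, hswap, mul_sub, mul_sub, ← mul_assoc ε ε, h4, zero_mul]
    simp only [mul_neg, neg_mul, mul_assoc]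
    abel
  obtain ⟨a, ha⟩ := hx _ h2
  refine ⟨a, mem_relationsMod.mpr ⟨contract s q, ?_⟩⟩
  convert ha using 1
  abel

/-- The counting theorem uses all hyperplanes, connectedness all but H₀. The counts agree: requiring
the vector of H₀ to stay out of the span of S already excludes H₀ from S and implies the condition
at H₀. -/
lemma nbcSum_erase [Fintype 𝒜.hyperplanes] [DecidableEq 𝒜.hyperplanes] (H₀ : 𝒜.hyperplanes)
    (r : 𝒜.hyperplanes → ℕ) :
    nbcSum 𝒜.vec (𝒜.vec H₀) r (⊥ : Submodule ℂ _) (Finset.univ.erase H₀) =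
      nbcSum 𝒜.vec (𝒜.vec H₀) r (⊥ : Submodule ℂ _) Finset.univ := by
  classical
  unfold nbcSum
  have hiff : ∀ S : Finset 𝒜.hyperplanes,
      IsNbc 𝒜.vec (𝒜.vec H₀) r (⊥ : Submodule ℂ _) (Finset.univ.erase H₀) S ↔
        IsNbc 𝒜.vec (𝒜.vec H₀) r (⊥ : Submodule ℂ _) Finset.univ S := by
    refine fun S => ⟨fun h => ⟨fun i _ => ?_, h.2⟩, fun h => ⟨fun i _ => h.1 i (by simp), h.2⟩⟩
    by_cases hi : i = H₀
    · subst hi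
      have hsub : {s | s ∈ S ∧ r i < r s} ⊆ (S : Set 𝒜.hyperplanes) := fun s hs => hs.1
      have hle := sup_le_sup_left (Submodule.span_mono (R := ℂ) (Set.image_mono (f := 𝒜.vec) hsub))
        (⊥ : Submodule ℂ _)
      exact fun hm => h.2 (hle hm)
    · exact h.1 i (by simpa using hi)
  rw [Finset.sum_congr rfl fun S _ => if_congr (hiff S) rfl rfl]
  refine Finset.sum_subset (Finset.powerset_mono.mpr (Finset.erase_subset _ _)) fun S _ hS => ?_
  refine if_neg fun h => hS (Finset.mem_powerset.mpr fun i hi => ?_)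
  refine Finset.mem_erase.mpr ⟨?_, Finset.mem_univ i⟩
  rintro rfl
  exact h.2 (Submodule.mem_sup_right (Submodule.subset_span ⟨i, hi, rfl⟩))

end Central

/-! ### The singular variety. -/

section Main

variable {ℓ : ℕ} {𝒜 : HyperplaneArrangement (Fin ℓ → ℂ)}

lemma mem_singularVariety_iff (x : 𝒜.V K) :
    x ∈ singularVariety K (𝒜.V K) (𝒜.OrlikSolomonAlgebra K) ↔
      ¬ ∀ q, ExteriorAlgebra.ι K x * q ∈ 𝒜.orlikSolomonIdeal K →
        ∃ a, q - ExteriorAlgebra.ι K x * a ∈ 𝒜.orlikSolomonIdeal K := by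
  have hmk : ∀ q : 𝒜.E K, ExteriorAlgebra.ι K x • Ideal.Quotient.mk (𝒜.orlikSolomonIdeal K) q =
      Ideal.Quotient.mk (𝒜.orlikSolomonIdeal K) (ExteriorAlgebra.ι K x * q) := fun q => rfl
  refine not_congr ⟨fun h q hq => ?_, fun h => Set.ext fun m => ?_⟩
  · have h1 : Ideal.Quotient.mk (𝒜.orlikSolomonIdeal K) q ∈
        {m : 𝒜.OrlikSolomonAlgebra K | ExteriorAlgebra.ι K x • m = 0} := by
      rw [Set.mem_ofPred_eq, hmk, Ideal.Quotient.eq_zero_iff_mem]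
      exact hq
    rw [h] at h1
    obtain ⟨a, ha⟩ := h1
    obtain ⟨a, rfl⟩ := Ideal.Quotient.mk_surjective a
    exact ⟨a, Ideal.Quotient.eq.mp ha.symm⟩
  · obtain ⟨q, rfl⟩ := Ideal.Quotient.mk_surjective m
    constructor
    · intro hq
      rw [Set.mem_ofPred_eq, hmk, Ideal.Quotient.eq_zero_iff_mem] at hq
      obtain ⟨a, ha⟩ := h q hq
      exact ⟨Ideal.Quotient.mk _ a, (Ideal.Quotient.eq.mpr ha).symm⟩
    · rintro ⟨a, ha⟩
      obtain ⟨a, rfl⟩ := Ideal.Quotient.mk_surjective a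
      rw [Set.mem_ofPred_eq, ← ha]
      change ExteriorAlgebra.ι K x • (ExteriorAlgebra.ι K x • _) = _
      rw [smul_smul, ExteriorAlgebra.ι_sq_zero, zero_smul]

/-- Distinct hyperplanes have nonproportional vectors, none proportional to w, so singletons contain
no broken circuit and the e_H are among the basis monomials. -/
lemma linearIndependent_eClass : LinearIndependent K (𝒜.eClass K) := by
  classical
  have := 𝒜.finite.fintype
  obtain ⟨r, hr⟩ := Countable.exists_injective_nat 𝒜.hyperplanes
  have hnbc : ∀ H : 𝒜.hyperplanes, IsNbc 𝒜.vec ((0, 1) : Dual ℂ (Fin ℓ → ℂ) × ℂ) r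
      (⊥ : Submodule ℂ _) Finset.univ {H} := by
    refine fun H => ⟨fun i _ => ?_, ?_⟩
    · rw [bot_sup_eq]
      by_cases h : r i < r H
      · have hne : i ≠ H := by rintro rfl; exact h.false
        refine fun hm => vec_notMem_span_singleton hne (Submodule.span_mono ?_ hm)
        rintro _ ⟨s, ⟨hs, -⟩, rfl⟩
        rw [Finset.mem_singleton.mp hs]
        rfl
      · have he : {s | s ∈ ({H} : Finset 𝒜.hyperplanes) ∧ r i < r s} = ∅ := by
          ext s
          simp only [Finset.mem_singleton, Set.mem_ofPred_eq, Set.mem_empty_iff_false, iff_false]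
          rintro ⟨rfl, hs⟩
          exact h hs
        rw [he, Set.image_empty, Submodule.span_empty, Submodule.mem_bot]
        exact vec_ne_zero i
    · rw [bot_sup_eq, Finset.coe_singleton, Set.image_singleton]
      intro hm
      obtain ⟨c, hc⟩ := Submodule.mem_span_singleton.mp hm
      have h1 : c • 𝒜.form H = 0 := congr_arg Prod.fst hc
      rcases smul_eq_zero.mp h1 with rfl | h1
      · rw [zero_smul] at hc
        exact one_ne_zero (congr_arg Prod.snd hc).symm
      · exact form_ne_zero H h1
  have hli := (isOrlikSolomon_relations (K := K) (𝒜 := 𝒜)).linearIndependent hr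
  have hli' := hli.comp (fun H => ⟨{H}, hnbc H⟩) fun H H' h => by simpa using h
  have h1 : (relations K 𝒜).mkQ ∘ (fun H => ExteriorAlgebra.ι K (𝒜.e K H)) =
      (fun S : {S : Finset 𝒜.hyperplanes // IsNbc 𝒜.vec ((0, 1) : Dual ℂ (Fin ℓ → ℂ) × ℂ) r
        (⊥ : Submodule ℂ _) Finset.univ S} => (relations K 𝒜).mkQ (mono K S.1.toList)) ∘
        fun H => ⟨{H}, hnbc H⟩ := by
    funext H
    simp [mono, e]
  rw [← h1] at hli'
  rw [linearIndependent_iff'] at hli' ⊢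
  intro s g hg
  refine hli' s g ?_
  have h2 : ∑ i ∈ s, g i • ExteriorAlgebra.ι K (𝒜.e K i) ∈ 𝒜.orlikSolomonIdeal K := by
    rw [← Ideal.Quotient.eq_zero_iff_mem, map_sum]
    exact hg
  have h3 : (relations K 𝒜).mkQ (∑ i ∈ s, g i • ExteriorAlgebra.ι K (𝒜.e K i)) = 0 := by
    rw [Submodule.mkQ_apply, Submodule.Quotient.mk_eq_zero]
    exact h2
  rw [map_sum] at h3
  exact h3

lemma IsIrreducible.mem_singularVariety_of_not_isCentral (h : 𝒜.IsIrreducible)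
    (hc : ¬ 𝒜.IsCentral) (x : 𝒜.V K) :
    x ∈ singularVariety K (𝒜.V K) (𝒜.OrlikSolomonAlgebra K) := by
  rw [mem_singularVariety_iff]
  intro hx
  have := 𝒜.finite.fintype
  obtain ⟨r, hr⟩ := Countable.exists_injective_nat 𝒜.hyperplanes
  exact nbcSum_ne_zero hr (h.isConn_of_not_isCentral hc)
    ((isOrlikSolomon_relations (K := K)).nbcSum_eq_zero hr x hx)

lemma IsIrreducible.mem_singularVariety_iff_of_isCentral (h : 𝒜.IsIrreducible)
    (hc : 𝒜.IsCentral) (x : 𝒜.V K) :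
    x ∈ singularVariety K (𝒜.V K) (𝒜.OrlikSolomonAlgebra K) ↔
      coordSum K 𝒜.hyperplanes x = 0 := by
  classical
  rw [mem_singularVariety_iff]
  constructor
  · intro hx
    by_contra h0
    -- If xq vanishes in A, then so does ∂(xq) = s(x)q - x∂q, hence q ≡ x · s(x)⁻¹∂q.
    refine hx fun q hq =>
      ⟨(coordSum K 𝒜.hyperplanes x)⁻¹ • contract (coordSum K 𝒜.hyperplanes) q, ?_⟩
    have h1 := hc.contract_mem hq
    rw [contract_ι_mul] at h1
    have h2 := (relations K 𝒜).smul_mem (coordSum K 𝒜.hyperplanes x)⁻¹ h1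
    rw [smul_sub, inv_smul_smul₀ h0] at h2
    rw [mul_smul_comm]
    exact h2
  · intro h0 hx
    have := 𝒜.finite.fintype
    obtain ⟨r, hr⟩ := Countable.exists_injective_nat 𝒜.hyperplanes
    obtain ⟨H, hH⟩ := h.1
    refine nbcSum_ne_zero hr (h.isConn_of_isCentral hc ⟨H, hH⟩) ?_
    rw [nbcSum_erase]
    exact (hc.isOrlikSolomon_relationsMod (K := K) ⟨H, hH⟩).nbcSum_eq_zero hr x
      (hc.exact_relationsMod ⟨H, hH⟩ h0 hx)

lemma span_sub_eq_ker_coordSum (H₀ : 𝒜.hyperplanes) :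
    Submodule.span K {v | ∃ i j : 𝒜.hyperplanes, v = 𝒜.e K i - 𝒜.e K j} =
      LinearMap.ker (coordSum K 𝒜.hyperplanes) := by
  apply le_antisymm
  · rw [Submodule.span_le]
    rintro _ ⟨i, j, rfl⟩
    simp [e]
  · intro x hx
    have key : ∀ x : 𝒜.V K, x - coordSum K 𝒜.hyperplanes x • 𝒜.e K H₀ ∈
        Submodule.span K {v | ∃ i j : 𝒜.hyperplanes, v = 𝒜.e K i - 𝒜.e K j} := by
      intro x
      induction x using Finsupp.induction_linear with
      | zero => simp
      | add x y hx hy =>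
        have := add_mem hx hy
        rwa [sub_add_sub_comm, ← add_smul, ← map_add] at this
      | single i c =>
        have h1 : (Finsupp.single i c : 𝒜.V K) = c • 𝒜.e K i := by simp [e]
        rw [coordSum_single, h1, ← smul_sub]
        exact Submodule.smul_mem _ _ (Submodule.subset_span ⟨i, H₀, rfl⟩)
    have := key x
    rwa [LinearMap.mem_ker.mp hx, zero_smul, sub_zero] at this

end Main

end HyperplaneArrangement

open HyperplaneArrangement OrlikSolomon in
theorem theorem2p2 (K : Type*) [Field K] (ℓ : ℕ) (𝒜 : HyperplaneArrangement (Fin ℓ → ℂ))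
    (hess : 𝒜.IsEssential) (hirr : 𝒜.IsIrreducible) :
    LinearIndependent K (𝒜.eClass K) ∧
    (¬ 𝒜.IsCentral → singularVariety K (𝒜.V K) (𝒜.OrlikSolomonAlgebra K) = Set.univ) ∧
    (𝒜.IsCentral →
      singularVariety K (𝒜.V K) (𝒜.OrlikSolomonAlgebra K) =
        (Submodule.span K {v | ∃ i j : 𝒜.hyperplanes, v = 𝒜.e K i - 𝒜.e K j} : Set (𝒜.V K)) ∧
      IsCoatom (Submodule.span K {v | ∃ i j : 𝒜.hyperplanes, v = 𝒜.e K i - 𝒜.e K j})) := by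
  refine ⟨linearIndependent_eClass, fun hc => ?_, fun hc => ?_⟩
  · exact Set.eq_univ_of_forall fun x => hirr.mem_singularVariety_of_not_isCentral hc x
  · obtain ⟨H, hH⟩ := hirr.1
    rw [span_sub_eq_ker_coordSum ⟨H, hH⟩]
    refine ⟨Set.ext fun x => hirr.mem_singularVariety_iff_of_isCentral hc x, ?_⟩
    exact LinearMap.isCoatom_ker_of_surjective fun c =>
      ⟨Finsupp.single ⟨H, hH⟩ c, coordSum_single _ _⟩
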